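/- Let $N\ge 1$ and let $G(x,t)=(4\pi t)^{-N/2}e^{-|x|^2/(4t)}$ be the heat kernel on $\mathbb{R}^N$. Let $u_0\in L^1(\mathbb{R}^N)$ and $f\in L^1(\mathbb{R}^N\times(0,\infty))$, and let $u\in C([0,\infty);L^1(\mathbb{R}^N))$ be the solution of the Cauchy problem $$u_t=\Delta u+f \quad\text{in } \mathbb{R}^N\times(0,\infty),\qquad u(\cdot,0)=u_0,$$ in the weak sense: $u(0)=u_0$ and, for every $\varphi\in C_c^\infty(\mathbb{R}^N)$ and $t\ge 0$, $$\int_{\mathbb{R}^N} u(t)\varphi\,dx=\int_{\mathbb{R}^N} u_0\varphi\,dx+\int_0^t\Big(\int_{\mathbb{R}^N} u(s)\Delta\varphi\,dx+\int_{\mathbb{R}^N} f(s)\varphi\,dx\Big)ds .$$ Then the limit $I_\infty:=\lim_{t\to\infty}\int_{\mathbb{R}^N}u(x,t)\,dx$ exists and is finite, $$I_\infty=\int_{\mathbb{R}^N}u_0(x)\,dx+\int_0^\infty\!\!\int_{\mathbb{R}^N}f(x,t)\,dx\,dt ,\qquad\text{and}\qquad \lim_{t\to\infty}\|u(t)-I_\infty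 G(t)\|_1=0 .$$ Assume further that, for some $p\in[1,\infty]$, $f(t)\in L^p(\mathbb{R}^N)$ for every $t>0$ and $$\lim_{t\to\infty}t^{1+\frac N2(1-\frac1p)}\|f(t)\|_p=0 .$$ Then, for the same $p$, $$\lim_{t\to\infty}t^{\frac N2(1-\frac1p)}\|u(t)-I_\infty G(t)\|_p=0 ,$$ and, for all sufficiently large $t$, $u(t)$ has a locally integrable generalized gradient $\nabla u(t)$, with $$\lim_{t\to\infty}t^{\frac N2(1-\frac1p)+\frac12}\|\nabla u(t)-I_\infty\nabla G(t)\|_p=0 .$$ -/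

import Mathlib

open MeasureTheory Filter Topology Set
open scoped ENNReal ContDiff

/-- The fundamental solution `G(x,t) = (4πt)^{-N/2} exp(-|x|²/(4t))` of the heat equation
on `ℝ^N` (used for `t > 0` only). -/
noncomputable def heatKernel {N : ℕ} (t : ℝ) (x : EuclideanSpace ℝ (Fin N)) : ℝ :=
  (4 * Real.pi * t) ^ (-(N : ℝ) / 2) * Real.exp (-‖x‖ ^ 2 / (4 * t))

/-- `u` is the solution of the Cauchy problem `u_t = Δu + f` in `ℝ^N × (0,∞)`, `u(·,0) = u₀`,
for `u₀ ∈ L¹(ℝ^N)` and `f ∈ L¹(ℝ^N × (0,∞))`: the curve `t ↦ u t` belongs to `C([0,∞); L¹(ℝ^N))`,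
takes the initial value `u₀`, and the equation holds in the weak sense, that is, for every test
function `φ ∈ C_c^∞(ℝ^N)` the function `t ↦ ∫ u(t) φ` is absolutely continuous with derivative
`∫ u(t) Δφ + ∫ f(t) φ` (written in its integrated form). -/
structure IsHeatSolution {N : ℕ} (u₀ : EuclideanSpace ℝ (Fin N) → ℝ)
    (f u : ℝ → EuclideanSpace ℝ (Fin N) → ℝ) : Prop where
  integrable : ∀ t : ℝ, 0 ≤ t → Integrable (u t) volume
  continuous : ∀ t : ℝ, 0 ≤ t →
    Tendsto (fun s : ℝ => eLpNorm (fun x => u s x - u t x) 1 volume) (𝓝[Ici 0] t) (𝓝 0)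
  initial : u 0 =ᵐ[volume] u₀
  weak : ∀ φ : EuclideanSpace ℝ (Fin N) → ℝ, ContDiff ℝ ∞ φ → HasCompactSupport φ →
    ∀ t : ℝ, 0 ≤ t →
      ∫ x, u t x * φ x = (∫ x, u₀ x * φ x) +
        ∫ s in (0 : ℝ)..t, ((∫ x, u s x * Laplacian.laplacian φ x) + ∫ x, f s x * φ x)

/-- `g` is the generalized (weak) gradient of `v` on `ℝ^N`. -/
structure IsWeakGradient {N : ℕ} (v : EuclideanSpace ℝ (Fin N) → ℝ)
    (g : EuclideanSpace ℝ (Fin N) → EuclideanSpace ℝ (Fin N)) : Prop where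
  locallyIntegrable : LocallyIntegrable v volume
  locallyIntegrable_gradient : LocallyIntegrable g volume
  integral_eq : ∀ φ : EuclideanSpace ℝ (Fin N) → ℝ, ContDiff ℝ ∞ φ → HasCompactSupport φ →
    ∫ x, v x • gradient φ x = -∫ x, φ x • g x

/-! The argument rests on Duhamel's formula. For 0 ≤ τ < t it reads u(t) = G(t-τ) * u(τ) + ∫_τ^t
G(t-s) * f(s) ds a.e., which `heatEvolution` and `heatSource` express. To get it from the weak
formulation, the test functions are extended by cutoff to plane waves cos(⟨ξ,x⟩+θ), which are
bounded eigenfunctions of Δ with eigenvalue -|ξ|². Each function t ↦ ∫ u(t) cos(⟨ξ,x⟩+θ) then solves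
a scalar linear equation. Variation of constants gives Duhamel's formula tested against plane waves,
and injectivity of the Fourier transform on L¹ removes the test
(`IsHeatSolution.ae_eq_heatEvolution_add_heatSource`).

The mass limit is the case ξ = 0. For L¹ convergence take τ = 0: u(t) - I G(t) is a superposition,
with weights u₀ and f, of the differences G(t-s, x-y) - G(t, x), the first kernel being replaced by
0 when s ≥ t. These have L¹ norm at most 2 and, by parabolic scaling, tend to 0 in L¹ for each fixed
(s, y); dominated convergence concludes.

For the L^p statements take τ = t/2 and use G(t) = G(t/2) * G(t/2): u(t) - I G(t) = G(t/2) * (u(t/2)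
- I G(t/2)) + ∫_{t/2}^t G(t-s) * f(s) ds. In the first term the L¹ to L^p smoothing of G(t/2) yields
t^{-α}, α = (N/2)(1-1/p), times a factor that vanishes by the L¹ result. In the second, ‖f(s)‖_p =
o(t^{-1-α}) on an interval of length t/2. A gradient on the kernel costs t^{-1/2} in the first term
and the integrable singularity (t-s)^{-1/2} in the second. The estimates are Young inequalities
obtained from Minkowski's integral inequality. Throughout, `(p⁻¹).toReal` plays the role of 1/p and
equals 0 at p = ∞. -/

/-! ### Minkowski's integral inequality and L^p interpolation -/

section IntegralInequalities

variable {X Z : Type*} [MeasurableSpace X] [MeasurableSpace Z] {μ : Measure X} {ν : Measure Z}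

/-- Minkowski's integral inequality for a finite exponent, with a positive majorant `M`. -/
theorem lintegral_rpow_lintegral_le_of_pos [SFinite μ] [SFinite ν] {F : X → Z → ℝ≥0∞}
    (hF : Measurable (Function.uncurry F)) {M : Z → ℝ≥0∞} (hM : Measurable M)
    (hM0 : ∀ z, M z ≠ 0) (hMfin : ∫⁻ z, M z ∂ν ≠ ⊤) {q : ℝ} (hq : 1 < q)
    (h : ∀ᵐ z ∂ν, ∫⁻ x, F x z ^ q ∂μ ≤ M z ^ q) :
    ∫⁻ x, (∫⁻ z, F x z ∂ν) ^ q ∂μ ≤ (∫⁻ z, M z ∂ν) ^ q := by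
  have hq0 : 0 < q := by linarith
  have hMtop : ∀ᵐ z ∂ν, M z < ⊤ := ae_lt_top hM hMfin
  have hconj := Real.HolderConjugate.conjExponent hq
  set q' := q.conjExponent with hq'
  have hq'0 : 0 < q' := hconj.symm.pos
  have hqq' : q / q' = q - 1 := hconj.div_conj_eq_sub_one
  set A := ∫⁻ z, M z ∂ν with hA
  have hFx : ∀ x, Measurable (F x) := fun x => hF.of_uncurry_left
  have hFz : ∀ z, Measurable (fun x => F x z) := fun z => hF.of_uncurry_right
  -- Hölder in z for the splitting F = M^{1/q'} · (F M^{-1/q'}). The weight M^{1-q} it produces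
  -- turns the bound M^q on ∫ F^q dμ back into M, which needs M nonzero and a.e. finite.
  have key : ∀ x, (∫⁻ z, F x z ∂ν) ^ q ≤ A ^ (q - 1) * ∫⁻ z, F x z ^ q * M z ^ (1 - q) ∂ν := by
    intro x
    have h1 : ∫⁻ z, F x z ∂ν = ∫⁻ z, ((fun z => M z ^ (1 / q')) *
        fun z => F x z * M z ^ (-(1 / q'))) z ∂ν := by
      refine lintegral_congr_ae ?_
      filter_upwards [hMtop] with z hz
      simp only [Pi.mul_apply]
      rw [mul_left_comm, ← ENNReal.rpow_add _ _ (hM0 z) hz.ne]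
      simp
    have h2 := ENNReal.lintegral_mul_le_Lp_mul_Lq ν hconj.symm
      (f := fun z => M z ^ (1 / q')) (g := fun z => F x z * M z ^ (-(1 / q')))
      (hM.pow_const _).aemeasurable ((hFx x).mul (hM.pow_const _)).aemeasurable
    rw [← h1] at h2
    refine (ENNReal.rpow_le_rpow h2 hq0.le).trans (le_of_eq ?_)
    rw [ENNReal.mul_rpow_of_nonneg _ _ hq0.le, ← ENNReal.rpow_mul, ← ENNReal.rpow_mul]
    have e1 : 1 / q * q = 1 := by field_simp
    have e2 : 1 / q' * q = q - 1 := by rw [← hqq']; ring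
    rw [e1, e2, ENNReal.rpow_one]
    congr 2
    · refine lintegral_congr fun z => ?_
      rw [← ENNReal.rpow_mul, one_div_mul_cancel hq'0.ne', ENNReal.rpow_one]
    · funext z
      rw [ENNReal.mul_rpow_of_nonneg _ _ hq0.le, ← ENNReal.rpow_mul]
      congr 2
      rw [neg_mul, e2]; ring
  calc ∫⁻ x, (∫⁻ z, F x z ∂ν) ^ q ∂μ
      ≤ ∫⁻ x, A ^ (q - 1) * ∫⁻ z, F x z ^ q * M z ^ (1 - q) ∂ν ∂μ := lintegral_mono key
    _ = A ^ (q - 1) * ∫⁻ z, ∫⁻ x, F x z ^ q * M z ^ (1 - q) ∂μ ∂ν := by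
        rw [lintegral_const_mul, lintegral_lintegral_swap]
        · exact ((hF.pow_const _).mul ((hM.comp measurable_snd).pow_const _)).aemeasurable
        · exact Measurable.lintegral_prod_right
            ((hF.pow_const _).mul ((hM.comp measurable_snd).pow_const _))
    _ ≤ A ^ (q - 1) * ∫⁻ z, M z ∂ν := by
        gcongr 1
        refine lintegral_mono_ae ?_
        filter_upwards [h, hMtop] with z hz hzt
        rw [lintegral_mul_const _ ((hFz z).pow_const _)]
        calc (∫⁻ x, F x z ^ q ∂μ) * M z ^ (1 - q) ≤ M z ^ q * M z ^ (1 - q) := by gcongr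
          _ = M z := by rw [← ENNReal.rpow_add _ _ (hM0 z) hzt.ne]; simp
    _ = A ^ q := by
        rw [← hA]
        nth_rewrite 2 [← ENNReal.rpow_one A]
        rw [← ENNReal.rpow_add_of_nonneg _ _ (by linarith) zero_le_one]
        simp

/-- Minkowski's integral inequality for measurable functions. -/
theorem eLpNorm_lintegral_le_of_measurable [SFinite μ] [SigmaFinite ν] {F : X → Z → ℝ≥0∞}
    (hF : Measurable (Function.uncurry F)) {M : Z → ℝ≥0∞} (hM : Measurable M)
    {p : ℝ≥0∞} (hp : 1 ≤ p) (h : ∀ᵐ z ∂ν, eLpNorm (fun x => F x z) p μ ≤ M z) :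
    eLpNorm (fun x => ∫⁻ z, F x z ∂ν) p μ ≤ ∫⁻ z, M z ∂ν := by
  rcases eq_or_ne p ⊤ with rfl | hpt
  · have h1 : ∀ᵐ z ∂ν, ∀ᵐ x ∂μ, F x z ≤ M z := by
      filter_upwards [h] with z hz
      rw [eLpNorm_exponent_top] at hz
      filter_upwards [ae_le_eLpNormEssSup (f := fun x => F x z) (μ := μ)] with x hx
      exact hx.trans hz
    have h2 : ∀ᵐ x ∂μ, ∀ᵐ z ∂ν, F x z ≤ M z :=
      (Measure.ae_ae_comm (p := fun x z => F x z ≤ M z)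
        (measurableSet_le hF (hM.comp measurable_snd))).2 h1
    rw [eLpNorm_exponent_top]
    refine essSup_le_of_ae_le _ ?_
    filter_upwards [h2] with x hx
    exact lintegral_mono_ae hx
  have hp0 : p ≠ 0 := (zero_lt_one.trans_le hp).ne'
  rcases hp.eq_or_lt with rfl | hp1
  · simp only [eLpNorm_one_eq_lintegral_enorm, enorm_eq_self] at h ⊢
    rw [lintegral_lintegral_swap hF.aemeasurable]
    exact lintegral_mono_ae h
  have hq : 1 < p.toReal := by
    rw [← ENNReal.toReal_one]
    exact (ENNReal.toReal_lt_toReal ENNReal.one_ne_top hpt).2 hp1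
  have hq0 : 0 < p.toReal := by linarith
  -- M may vanish, so it is replaced by M + δ with δ positive everywhere and ∫ δ < ε; σ-finiteness
  -- provides such a δ.
  refine ENNReal.le_of_forall_pos_le_add fun ε hε hfin => ?_
  obtain ⟨δ, hδ, hδm, hδi⟩ := exists_pos_lintegral_lt_of_sigmaFinite ν
    (ε := (ε : ℝ≥0∞)) (by simpa using hε.ne')
  have hδm' : Measurable fun z => (δ z : ℝ≥0∞) := hδm.coe_nnreal_ennreal
  have hsum : ∫⁻ z, (M z + δ z) ∂ν = ∫⁻ z, M z ∂ν + ∫⁻ z, δ z ∂ν := lintegral_add_left hM _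
  have h3 := lintegral_rpow_lintegral_le_of_pos (M := fun z => M z + δ z) hF (hM.add hδm')
    (fun z => by simpa using fun _ => (hδ z).ne')
    (by rw [hsum]; exact (ENNReal.add_lt_top.2 ⟨hfin, hδi.trans ENNReal.coe_lt_top⟩).ne) hq
    (by
      filter_upwards [h] with z hz
      rw [eLpNorm_eq_lintegral_rpow_enorm_toReal hp0 hpt, one_div,
        ENNReal.rpow_inv_le_iff hq0] at hz
      simp only [enorm_eq_self] at hz
      exact hz.trans (ENNReal.rpow_le_rpow le_self_add hq0.le))
  rw [eLpNorm_eq_lintegral_rpow_enorm_toReal hp0 hpt, one_div, ENNReal.rpow_inv_le_iff hq0]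
  simp only [enorm_eq_self]
  refine h3.trans (ENNReal.rpow_le_rpow ?_ hq0.le)
  rw [hsum]
  gcongr

/-- **Minkowski's integral inequality**. -/
theorem eLpNorm_lintegral_le [SFinite μ] [SigmaFinite ν] {F : X → Z → ℝ≥0∞}
    (hF : AEMeasurable (Function.uncurry F) (μ.prod ν)) {M : Z → ℝ≥0∞} (hM : AEMeasurable M ν)
    {p : ℝ≥0∞} (hp : 1 ≤ p) (h : ∀ᵐ z ∂ν, eLpNorm (fun x => F x z) p μ ≤ M z) :
    eLpNorm (fun x => ∫⁻ z, F x z ∂ν) p μ ≤ ∫⁻ z, M z ∂ν := by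
  have h1 : ∀ᵐ x ∂μ, ∀ᵐ z ∂ν, F x z = hF.mk _ (x, z) := Measure.ae_ae_of_ae_prod hF.ae_eq_mk
  have h2 : ∀ᵐ z ∂ν, ∀ᵐ x ∂μ, F x z = hF.mk _ (x, z) :=
    Measure.ae_ae_of_ae_prod (p := fun y : Z × X => F y.2 y.1 = hF.mk _ (y.2, y.1))
      (Measure.measurePreserving_swap.quasiMeasurePreserving.ae hF.ae_eq_mk)
  have h3 : (fun x => ∫⁻ z, F x z ∂ν) =ᵐ[μ] fun x => ∫⁻ z, hF.mk _ (x, z) ∂ν := by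
    filter_upwards [h1] with x hx using lintegral_congr_ae hx
  rw [eLpNorm_congr_ae h3, lintegral_congr_ae hM.ae_eq_mk]
  refine eLpNorm_lintegral_le_of_measurable (F := fun x z => hF.mk _ (x, z))
    hF.measurable_mk hM.measurable_mk hp ?_
  filter_upwards [h, h2, hM.ae_eq_mk] with z hz hz2 hz3
  rwa [← eLpNorm_congr_ae hz2, ← hz3]

/-- A function bounded by `b` has `L^p` norm at most `b^{1-1/p} ‖·‖₁^{1/p}`. -/
theorem eLpNorm_le_rpow_mul_rpow {E : Type*} [NormedAddCommGroup E] {g : X → E} {b : ℝ≥0∞}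
    (hbt : b ≠ ⊤) (hb : ∀ x, ‖g x‖ₑ ≤ b) {p : ℝ≥0∞} (hp : 1 ≤ p) :
    eLpNorm g p μ ≤ b ^ (1 - (p⁻¹).toReal) * (∫⁻ x, ‖g x‖ₑ ∂μ) ^ (p⁻¹).toReal := by
  rcases eq_or_ne p ⊤ with rfl | hpt
  · simp only [eLpNorm_exponent_top, ENNReal.inv_top, ENNReal.toReal_zero, sub_zero,
      ENNReal.rpow_one, ENNReal.rpow_zero, mul_one]
    exact essSup_le_of_ae_le _ (Eventually.of_forall hb)
  have hp0 : p ≠ 0 := (zero_lt_one.trans_le hp).ne'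
  have hq : 1 ≤ p.toReal := by
    rw [← ENNReal.toReal_one]
    exact (ENNReal.toReal_le_toReal ENNReal.one_ne_top hpt).2 hp
  have hq0 : 0 < p.toReal := by linarith
  rw [eLpNorm_eq_lintegral_rpow_enorm_toReal hp0 hpt, one_div, ENNReal.rpow_inv_le_iff hq0,
    ENNReal.mul_rpow_of_nonneg _ _ hq0.le, ENNReal.toReal_inv, ← ENNReal.rpow_mul,
    ← ENNReal.rpow_mul, inv_mul_cancel₀ hq0.ne', ENNReal.rpow_one, sub_mul,
    inv_mul_cancel₀ hq0.ne', one_mul]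
  rw [← lintegral_const_mul' _ _ (ENNReal.rpow_ne_top_of_nonneg (by linarith) hbt)]
  refine lintegral_mono fun x => ?_
  calc ‖g x‖ₑ ^ p.toReal = ‖g x‖ₑ ^ (p.toReal - 1) * ‖g x‖ₑ := by
        nth_rewrite 3 [← ENNReal.rpow_one ‖g x‖ₑ]
        rw [← ENNReal.rpow_add_of_nonneg _ _ (by linarith) zero_le_one]; simp
    _ ≤ b ^ (p.toReal - 1) * ‖g x‖ₑ := by
        gcongr
        exact hb x

end IntegralInequalities

/-! ### Uniqueness from plane waves, and the scalar linear equation -/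

/-- An integrable function whose integrals against all `x ↦ cos (⟪ξ, x⟫ + θ)` vanish is zero. -/
theorem ae_eq_zero_of_integral_mul_cos {E : Type*} [NormedAddCommGroup E] [InnerProductSpace ℝ E]
    [CompleteSpace E] [SecondCountableTopology E] [MeasurableSpace E] [BorelSpace E]
    {μ : Measure E} {w : E → ℝ} (hw : Integrable w μ)
    (h : ∀ (ξ : E) (θ : ℝ), ∫ x, w x * Real.cos (inner ℝ ξ x + θ) ∂μ = 0) : w =ᵐ[μ] 0 := by
  have hm1 : AEMeasurable (fun x => ENNReal.ofReal (w x)) μ := hw.aemeasurable.ennreal_ofReal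
  have hm2 : AEMeasurable (fun x => ENNReal.ofReal (-w x)) μ := hw.neg.aemeasurable.ennreal_ofReal
  have hf1 : ∫⁻ x, ENNReal.ofReal (w x) ∂μ ≠ ⊤ := hw.lintegral_lt_top.ne
  have hf2 : ∫⁻ x, ENNReal.ofReal (-w x) ∂μ ≠ ⊤ := hw.neg.lintegral_lt_top.ne
  have : IsFiniteMeasure (μ.withDensity fun x => ENNReal.ofReal (w x)) :=
    isFiniteMeasure_withDensity hf1
  have : IsFiniteMeasure (μ.withDensity fun x => ENNReal.ofReal (-w x)) :=
    isFiniteMeasure_withDensity hf2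
  -- The positive and negative parts of w are densities of finite measures, which are determined by
  -- their characteristic functions.
  have key : (μ.withDensity fun x => ENNReal.ofReal (w x)) =
      μ.withDensity fun x => ENNReal.ofReal (-w x) := by
    refine Measure.ext_of_charFun (funext fun ξ => ?_)
    have hbd : ∀ᵐ x ∂μ, ‖Complex.exp (inner ℝ x ξ * Complex.I)‖ ≤ 1 :=
      Eventually.of_forall fun x => (Complex.norm_exp_ofReal_mul_I _).le
    have hcont : AEStronglyMeasurable (fun x : E => Complex.exp (inner ℝ x ξ * Complex.I)) μ := by
      apply Continuous.aestronglyMeasurable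
      fun_prop
    have hi : ∀ g : E → ℝ, Integrable g μ →
        Integrable (fun x => g x • Complex.exp (inner ℝ x ξ * Complex.I)) μ :=
      fun g hg => hg.smul_bdd 1 hcont hbd
    rw [charFun_apply, charFun_apply,
      integral_withDensity_eq_integral_toReal_smul₀ hm1 (by simp),
      integral_withDensity_eq_integral_toReal_smul₀ hm2 (by simp), ← sub_eq_zero,
      ← integral_sub]
    rotate_left
    · exact hi _ hw.real_toNNReal
    · exact hi _ hw.neg.real_toNNReal
    -- The phases θ = 0 and θ = -π/2 give the cosine and the sine, hence the real and imaginary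
    -- parts of the difference of characteristic functions.
    have e : ∀ x, (ENNReal.ofReal (w x)).toReal • Complex.exp (inner ℝ x ξ * Complex.I) -
        (ENNReal.ofReal (-w x)).toReal • Complex.exp (inner ℝ x ξ * Complex.I) =
        ((w x * Real.cos (inner ℝ ξ x + 0) : ℝ) : ℂ) +
          ((w x * Real.cos (inner ℝ ξ x + -(Real.pi / 2)) : ℝ) : ℂ) * Complex.I := by
      intro x
      rw [← sub_smul, ENNReal.toReal_ofReal', ENNReal.toReal_ofReal']
      rw [max_zero_sub_eq_self, Complex.exp_mul_I, add_zero, ← sub_eq_add_neg, Real.cos_sub_pi_div_two,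
        real_inner_comm, Complex.real_smul]
      push_cast
      ring
    simp_rw [e]
    rw [integral_add, integral_mul_const, integral_complex_ofReal, integral_complex_ofReal, h, h]
    · simp
    · refine Integrable.ofReal (hw.mul_bdd (c := 1) (Continuous.aestronglyMeasurable (by fun_prop)) ?_)
      exact Eventually.of_forall fun x => Real.abs_cos_le_one _
    · refine Integrable.mul_const (Integrable.ofReal
        (hw.mul_bdd (c := 1) (Continuous.aestronglyMeasurable (by fun_prop)) ?_)) _
      exact Eventually.of_forall fun x => Real.abs_cos_le_one _
  filter_upwards [(withDensity_eq_iff hm1 hm2 hf1).1 key] with x hx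
  rcases le_total (w x) 0 with h0 | h0
  · rw [ENNReal.ofReal_of_nonpos h0, eq_comm, ENNReal.ofReal_eq_zero] at hx
    simpa using le_antisymm h0 (by linarith)
  · rw [ENNReal.ofReal_of_nonpos (p := -w x) (by linarith), ENNReal.ofReal_eq_zero] at hx
    simpa using le_antisymm hx h0

/-- Variation of constants for the scalar equation `c' = -λ c + F` in integrated form. -/
theorem eq_exp_mul_add_integral_of_integral_eq {l τ t : ℝ} {c F : ℝ → ℝ} (hτt : τ ≤ t)
    (hF : IntervalIntegrable F volume τ t) (hc : IntervalIntegrable c volume τ t)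
    (h : ∀ s ∈ Icc τ t, c s = c τ + ∫ r in τ..s, (-l * c r + F r)) :
    c t = Real.exp (-l * (t - τ)) * c τ + ∫ s in τ..t, Real.exp (-l * (t - s)) * F s := by
  have hg : IntervalIntegrable (fun r => -l * c r + F r) volume τ t := (hc.const_mul _).add hF
  -- F is only integrable, so c is merely absolutely continuous; the integrating factor e^{ls} is
  -- handled by integration by parts for absolutely continuous functions.
  have hac : AbsolutelyContinuousOnInterval
      (fun s => ∫ r in τ..s, (-l * c r + F r)) τ t :=
    hg.absolutelyContinuousOnInterval_intervalIntegral left_mem_uIcc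
  have hexp : AbsolutelyContinuousOnInterval (fun s => Real.exp (l * s)) τ t :=
    ContDiffOn.absolutelyContinuousOnInterval (by fun_prop)
  have hderiv : ∀ s, deriv (fun s => Real.exp (l * s)) s = l * Real.exp (l * s) := by
    intro s
    have := ((hasDerivAt_id s).const_mul l).exp.deriv
    simp only [id] at this
    rw [this]; ring
  have hparts := hexp.integral_deriv_mul_eq_sub hac
  have e1 : ∫ s in τ..t, (deriv (fun s => Real.exp (l * s)) s * (∫ r in τ..s, (-l * c r + F r)) +
      Real.exp (l * s) * deriv (fun s => ∫ r in τ..s, (-l * c r + F r)) s) =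
      ∫ s in τ..t, (Real.exp (l * s) * F s - c τ * (l * Real.exp (l * s))) := by
    refine intervalIntegral.integral_congr_ae ?_
    filter_upwards [hg.ae_hasDerivAt_integral] with s hs hmem
    have hmem' : s ∈ Icc τ t := by
      rw [uIoc_of_le hτt] at hmem; exact Ioc_subset_Icc_self hmem
    rw [(hs (by rwa [uIcc_of_le hτt]) τ left_mem_uIcc).deriv, hderiv]
    have := h s hmem'
    rw [show (∫ r in τ..s, (-l * c r + F r)) = c s - c τ by linarith]
    ring
  have e2 : ∫ s in τ..t, c τ * (l * Real.exp (l * s)) =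
      c τ * (Real.exp (l * t) - Real.exp (l * τ)) := by
    rw [intervalIntegral.integral_const_mul]
    congr 1
    simp_rw [← hderiv]
    exact intervalIntegral.integral_deriv_eq_sub (fun x _ => by fun_prop)
      (by simp_rw [funext hderiv]; exact Continuous.intervalIntegrable (by fun_prop) _ _)
  have hint : IntervalIntegrable (fun s => Real.exp (l * s) * F s) volume τ t :=
    hF.continuousOn_mul (by fun_prop)
  rw [e1, intervalIntegral.integral_sub hint
    (Continuous.intervalIntegrable (by fun_prop) _ _), e2] at hparts
  simp only [intervalIntegral.integral_same, mul_zero, sub_zero] at hparts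
  have ht := h t (right_mem_Icc.2 hτt)
  rw [show (∫ r in τ..t, (-l * c r + F r)) = c t - c τ by linarith] at hparts
  have e3 : ∫ s in τ..t, Real.exp (-l * (t - s)) * F s =
      Real.exp (-l * t) * ∫ s in τ..t, Real.exp (l * s) * F s := by
    rw [← intervalIntegral.integral_const_mul]
    refine intervalIntegral.integral_congr fun s _ => ?_
    rw [← mul_assoc, ← Real.exp_add]
    congr 2; ring
  rw [e3, show (∫ s in τ..t, Real.exp (l * s) * F s) =
    Real.exp (l * t) * c t - c τ * Real.exp (l * τ) by linarith]
  have h4 : Real.exp (-l * t) * Real.exp (l * t) = 1 := by rw [← Real.exp_add]; simp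
  have h5 : Real.exp (-l * (t - τ)) = Real.exp (-l * t) * Real.exp (l * τ) := by
    rw [← Real.exp_add]; congr 1; ring
  rw [h5]
  linear_combination (-c t) * h4

/-! ### The heat kernel: Fourier identity, gradient, L^p bounds -/

section HeatKernel

variable {N : ℕ}

theorem heatKernel_nonneg {t : ℝ} (ht : 0 ≤ t) (x : EuclideanSpace ℝ (Fin N)) :
    0 ≤ heatKernel t x := by
  unfold heatKernel; positivity

theorem measurable_heatKernel_uncurry :
    Measurable fun q : ℝ × EuclideanSpace ℝ (Fin N) => heatKernel q.1 q.2 := by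
  unfold heatKernel; fun_prop

theorem contDiff_heatKernel (t : ℝ) :
    ContDiff ℝ ∞ (heatKernel t : EuclideanSpace ℝ (Fin N) → ℝ) := by
  unfold heatKernel
  have : ContDiff ℝ ∞ fun x : EuclideanSpace ℝ (Fin N) => ‖x‖ ^ 2 := contDiff_norm_sq ℝ
  fun_prop

theorem continuous_heatKernel (t : ℝ) :
    Continuous (heatKernel t : EuclideanSpace ℝ (Fin N) → ℝ) := (contDiff_heatKernel t).continuous

/-- The heat kernel acts on the plane wave `x ↦ cos (⟪ξ, x⟫ + θ)` by the factor `e^{-|ξ|²t}`. -/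
theorem integral_heatKernel_mul_cos {t : ℝ} (ht : 0 < t) (ξ : EuclideanSpace ℝ (Fin N)) (θ : ℝ) :
    ∫ x, heatKernel t x * Real.cos (inner ℝ ξ x + θ) = Real.exp (-‖ξ‖ ^ 2 * t) * Real.cos θ := by
  have hb : 0 < ((1 / (4 * t) : ℝ) : ℂ).re := by
    rw [Complex.ofReal_re]; positivity
  have h := GaussianFourier.integral_cexp_neg_mul_sq_norm_add hb Complex.I ξ
  have hpos : (0 : ℝ) < 4 * Real.pi * t := by positivity
  have e1 : ((Real.pi : ℂ) / ((1 / (4 * t) : ℝ) : ℂ)) ^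
      ((Module.finrank ℝ (EuclideanSpace ℝ (Fin N)) : ℂ) / 2) =
      (((4 * Real.pi * t) ^ ((N : ℝ) / 2) : ℝ) : ℂ) := by
    rw [Complex.ofReal_cpow hpos.le, finrank_euclideanSpace_fin]
    congr 1
    · push_cast; field_simp
    · push_cast; ring
  have e2 : Complex.I ^ 2 * (‖ξ‖ : ℂ) ^ 2 / (4 * ((1 / (4 * t) : ℝ) : ℂ)) =
      ((-‖ξ‖ ^ 2 * t : ℝ) : ℂ) := by
    have : (t : ℂ) ≠ 0 := by exact_mod_cast ht.ne'
    rw [Complex.I_sq]; push_cast; field_simp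
  rw [e1, e2] at h
  have hint := GaussianFourier.integrable_cexp_neg_mul_sq_norm_add hb Complex.I ξ
  -- The integrand is the real part of e^{iθ} times a complex Gaussian with quadratic coefficient
  -- 1/(4t) and linear term i⟨ξ,x⟩.
  have e3 : ∀ x : EuclideanSpace ℝ (Fin N), heatKernel t x * Real.cos (inner ℝ ξ x + θ) =
      ((((4 * Real.pi * t) ^ (-(N : ℝ) / 2) : ℝ) : ℂ) * Complex.exp (θ * Complex.I) *
        Complex.exp (-((1 / (4 * t) : ℝ) : ℂ) * (‖x‖ : ℂ) ^ 2 + Complex.I * inner ℝ ξ x)).re := by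
    intro x
    have : -((1 / (4 * t) : ℝ) : ℂ) * (‖x‖ : ℂ) ^ 2 + Complex.I * inner ℝ ξ x =
      ((-‖x‖ ^ 2 / (4 * t) : ℝ) : ℂ) + (inner ℝ ξ x : ℝ) * Complex.I := by
      push_cast; ring
    rw [this, Complex.exp_add, mul_assoc, mul_left_comm (Complex.exp _), ← Complex.exp_add,
      ← add_mul, ← Complex.ofReal_add, ← Complex.ofReal_exp, Complex.re_ofReal_mul,
      Complex.re_ofReal_mul, Complex.exp_ofReal_mul_I_re, heatKernel, add_comm θ, mul_assoc]
  simp_rw [e3]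
  refine (integral_re (hint.const_mul _)).trans ?_
  rw [RCLike.re_to_complex, integral_const_mul, h, ← Complex.ofReal_exp, mul_assoc,
    Complex.re_ofReal_mul, mul_left_comm, Complex.re_ofReal_mul, mul_comm (Complex.exp _),
    Complex.re_ofReal_mul, Complex.exp_ofReal_mul_I_re, ← mul_assoc, ← Real.rpow_add hpos]
  have : -(N : ℝ) / 2 + N / 2 = 0 := by ring
  rw [this, Real.rpow_zero, one_mul]

theorem integral_heatKernel {t : ℝ} (ht : 0 < t) :
    ∫ x : EuclideanSpace ℝ (Fin N), heatKernel t x = 1 := by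
  simpa using integral_heatKernel_mul_cos ht (0 : EuclideanSpace ℝ (Fin N)) 0

/-- A non-integrable function has Bochner integral 0 by convention, which contradicts total mass 1.
-/
theorem integrable_heatKernel {t : ℝ} (ht : 0 < t) :
    Integrable (heatKernel t : EuclideanSpace ℝ (Fin N) → ℝ) := by
  by_contra h
  simpa [integral_undef h] using integral_heatKernel (N := N) ht

theorem lintegral_enorm_heatKernel {t : ℝ} (ht : 0 < t) :
    ∫⁻ x : EuclideanSpace ℝ (Fin N), ‖heatKernel t x‖ₑ = 1 := by
  rw [← ofReal_integral_norm_eq_lintegral_enorm (integrable_heatKernel ht)]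
  simp_rw [Real.norm_of_nonneg (heatKernel_nonneg ht.le _)]
  rw [integral_heatKernel ht, ENNReal.ofReal_one]

theorem integral_heatKernel_sub_mul_cos {t : ℝ} (ht : 0 < t) (ξ y : EuclideanSpace ℝ (Fin N))
    (θ : ℝ) : ∫ x, heatKernel t (x - y) * Real.cos (inner ℝ ξ x + θ) =
      Real.exp (-‖ξ‖ ^ 2 * t) * Real.cos (inner ℝ ξ y + θ) := by
  rw [← integral_heatKernel_mul_cos ht ξ, ← integral_add_right_eq_self _ y]
  simp_rw [add_sub_cancel_right, inner_add_right, add_assoc]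

theorem hasGradientAt_heatKernel (t : ℝ) (x : EuclideanSpace ℝ (Fin N)) :
    HasGradientAt (heatKernel t) (-(1 / (2 * t) * heatKernel t x) • x) x := by
  have h1 : HasFDerivAt (fun x : EuclideanSpace ℝ (Fin N) => ‖x‖ ^ 2) (2 • innerSL ℝ x) x :=
    (hasStrictFDerivAt_norm_sq x).hasFDerivAt
  have h2 := (((h1.neg.mul_const (4 * t)⁻¹).exp).const_mul ((4 * Real.pi * t) ^ (-(N : ℝ) / 2)))
  rw [hasGradientAt_iff_hasFDerivAt]
  refine h2.congr_fderiv ?_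
  ext v
  simp [heatKernel, div_eq_mul_inv]
  ring

theorem gradient_heatKernel (t : ℝ) (x : EuclideanSpace ℝ (Fin N)) :
    gradient (heatKernel t) x = -(1 / (2 * t) * heatKernel t x) • x :=
  (hasGradientAt_heatKernel t x).gradient

theorem continuous_gradient_heatKernel (t : ℝ) :
    Continuous (gradient (heatKernel t : EuclideanSpace ℝ (Fin N) → ℝ)) := by
  simp_rw [funext (gradient_heatKernel t)]
  have := continuous_heatKernel (N := N) t
  fun_prop

theorem measurable_gradient_heatKernel_uncurry :
    Measurable fun q : ℝ × EuclideanSpace ℝ (Fin N) => gradient (heatKernel q.1) q.2 := by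
  simp_rw [gradient_heatKernel]
  have := measurable_heatKernel_uncurry (N := N)
  fun_prop

theorem heatKernel_le {t : ℝ} (ht : 0 < t) (x : EuclideanSpace ℝ (Fin N)) :
    heatKernel t x ≤ (4 * Real.pi * t) ^ (-(N : ℝ) / 2) := by
  unfold heatKernel
  refine mul_le_of_le_one_right (by positivity) (Real.exp_le_one_iff.2 ?_)
  rw [neg_div]
  exact neg_nonpos.2 (by positivity)

/-- Half of the Gaussian exponent absorbs the factor |x|/√t; the other half is the exponent of
G(2t), whose normalization accounts for 2^{N/2}. Every norm of ∇G is thereby reduced to one of G. -/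
theorem norm_gradient_heatKernel_le {t : ℝ} (ht : 0 < t) (x : EuclideanSpace ℝ (Fin N)) :
    ‖gradient (heatKernel t) x‖ ≤
      2 * 2 ^ ((N : ℝ) / 2) * t ^ (-(1 / 2) : ℝ) * heatKernel (2 * t) x := by
  have hs : 0 < Real.sqrt t := Real.sqrt_pos.2 ht
  have hst : Real.sqrt t ^ 2 = t := Real.sq_sqrt ht.le
  have h1 : ‖x‖ ≤ 4 * Real.sqrt t * Real.exp (‖x‖ ^ 2 / (8 * t)) := by
    have h2 := Real.add_one_le_exp (‖x‖ ^ 2 / (8 * t))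
    have h3 : ‖x‖ ≤ 4 * Real.sqrt t * (‖x‖ ^ 2 / (8 * t) + 1) := by
      have : 4 * Real.sqrt t * (‖x‖ ^ 2 / (8 * t) + 1) =
        (‖x‖ ^ 2 + 8 * Real.sqrt t ^ 2) / (2 * Real.sqrt t) := by
        rw [← hst]; simp only [Real.sqrt_sq hs.le]; field_simp; ring
      rw [this, le_div_iff₀ (by positivity)]
      nlinarith [sq_nonneg (‖x‖ - Real.sqrt t), sq_nonneg (Real.sqrt t)]
    exact h3.trans (by gcongr)
  rw [gradient_heatKernel, norm_smul, norm_neg, Real.norm_of_nonneg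
    (mul_nonneg (by positivity) (heatKernel_nonneg ht.le x))]
  have e1 : heatKernel (2 * t) x = 2 ^ (-(N : ℝ) / 2) * (4 * Real.pi * t) ^ (-(N : ℝ) / 2) *
      Real.exp (-(‖x‖ ^ 2 / (8 * t))) := by
    rw [heatKernel, ← Real.mul_rpow (by positivity) (by positivity)]
    congr 2 <;> ring
  have e2 : heatKernel t x = (4 * Real.pi * t) ^ (-(N : ℝ) / 2) *
      (Real.exp (-(‖x‖ ^ 2 / (8 * t))) * Real.exp (-(‖x‖ ^ 2 / (8 * t)))) := by
    rw [heatKernel, ← Real.exp_add]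
    congr 2; field_simp; ring
  have e3 : t ^ (-(1 / 2) : ℝ) = (Real.sqrt t)⁻¹ := by
    rw [Real.rpow_neg ht.le, ← Real.sqrt_eq_rpow]
  have e4 : (2 : ℝ) ^ ((N : ℝ) / 2) * 2 ^ (-(N : ℝ) / 2) = 1 := by
    rw [← Real.rpow_add two_pos]; ring_nf; simp
  have e5 : Real.exp (-(‖x‖ ^ 2 / (8 * t))) * Real.exp (‖x‖ ^ 2 / (8 * t)) = 1 := by
    rw [← Real.exp_add]; simp
  calc 1 / (2 * t) * heatKernel t x * ‖x‖
      ≤ 1 / (2 * t) * heatKernel t x * (4 * Real.sqrt t * Real.exp (‖x‖ ^ 2 / (8 * t))) := by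
        gcongr
        exact mul_nonneg (by positivity) (heatKernel_nonneg ht.le x)
    _ = (Real.exp (-(‖x‖ ^ 2 / (8 * t))) * Real.exp (‖x‖ ^ 2 / (8 * t))) *
        (2 * (Real.sqrt t / t) * (4 * Real.pi * t) ^ (-(N : ℝ) / 2) *
          Real.exp (-(‖x‖ ^ 2 / (8 * t)))) := by
        rw [e2]; field_simp; ring
    _ = (2 : ℝ) ^ ((N : ℝ) / 2) * 2 ^ (-(N : ℝ) / 2) *
        (2 * (Real.sqrt t)⁻¹ * (4 * Real.pi * t) ^ (-(N : ℝ) / 2) *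
          Real.exp (-(‖x‖ ^ 2 / (8 * t)))) := by
        rw [e4, e5, Real.sqrt_div_self]
    _ = _ := by rw [e1, e3]; ring

/-- Interpolation between unit mass and the supremum (4πt)^{-N/2}. The factor 4π ≥ 1 is dropped
because its exponent is nonpositive. -/
theorem eLpNorm_heatKernel_le {t : ℝ} (ht : 0 < t) {p : ℝ≥0∞} (hp : 1 ≤ p) :
    eLpNorm (heatKernel t : EuclideanSpace ℝ (Fin N) → ℝ) p volume ≤
      ENNReal.ofReal (t ^ (-((N : ℝ) / 2 * (1 - (p⁻¹).toReal)))) := by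
  have hp1 : (p⁻¹).toReal ≤ 1 := by
    rw [← ENNReal.toReal_one]
    exact ENNReal.toReal_mono ENNReal.one_ne_top (ENNReal.inv_le_one.2 hp)
  refine (eLpNorm_le_rpow_mul_rpow (b := ENNReal.ofReal ((4 * Real.pi * t) ^ (-(N : ℝ) / 2)))
    ENNReal.ofReal_ne_top (fun x => ?_) hp).trans ?_
  · rw [← ofReal_norm, Real.norm_of_nonneg (heatKernel_nonneg ht.le x)]
    exact ENNReal.ofReal_le_ofReal (heatKernel_le ht x)
  rw [lintegral_enorm_heatKernel ht, ENNReal.one_rpow, mul_one,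
    ENNReal.ofReal_rpow_of_nonneg (by positivity) (by linarith), ← Real.rpow_mul (by positivity)]
  refine ENNReal.ofReal_le_ofReal ?_
  rw [show -(N : ℝ) / 2 * (1 - (p⁻¹).toReal) = -((N : ℝ) / 2 * (1 - (p⁻¹).toReal)) by ring]
  refine Real.rpow_le_rpow_of_nonpos ht ?_ ?_
  · nlinarith [Real.pi_gt_three]
  · exact neg_nonpos.2 (mul_nonneg (by positivity) (by linarith))

theorem eLpNorm_gradient_heatKernel_le {t : ℝ} (ht : 0 < t) {p : ℝ≥0∞} (hp : 1 ≤ p) :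
    eLpNorm (gradient (heatKernel t : EuclideanSpace ℝ (Fin N) → ℝ)) p volume ≤
      ENNReal.ofReal (2 * 2 ^ ((N : ℝ) / 2) *
        t ^ (-((N : ℝ) / 2 * (1 - (p⁻¹).toReal) + 1 / 2))) := by
  have hp1 : (p⁻¹).toReal ≤ 1 := by
    rw [← ENNReal.toReal_one]
    exact ENNReal.toReal_mono ENNReal.one_ne_top (ENNReal.inv_le_one.2 hp)
  refine (eLpNorm_le_mul_eLpNorm_of_ae_le_mul (g := heatKernel (2 * t))
    (c := 2 * 2 ^ ((N : ℝ) / 2) * t ^ (-(1 / 2) : ℝ)) (Eventually.of_forall fun x => ?_) p).trans ?_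
  · rw [Real.norm_of_nonneg (heatKernel_nonneg (by positivity) x)]
    exact norm_gradient_heatKernel_le ht x
  · refine (mul_le_mul_right (eLpNorm_heatKernel_le (by positivity) hp) _).trans ?_
    rw [← ENNReal.ofReal_mul (by positivity)]
    refine ENNReal.ofReal_le_ofReal ?_
    rw [mul_assoc, neg_add, add_comm (-_), Real.rpow_add ht]
    gcongr 2 * 2 ^ ((N : ℝ) / 2) * (t ^ (-(1 / 2) : ℝ) * ?_)
    refine Real.rpow_le_rpow_of_nonpos ht (by linarith) ?_
    exact neg_nonpos.2 (mul_nonneg (by positivity) (by linarith))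

end HeatKernel

/-! ### Asymptotic invariance of the heat kernel under space-time shifts -/

section HeatKernelShift

variable {N : ℕ}

theorem heatKernel_mul_sqrt_smul {t σ : ℝ} (ht : 0 < t) (hσ : 0 ≤ σ)
    (z : EuclideanSpace ℝ (Fin N)) :
    heatKernel (t * σ) (Real.sqrt t • z) = t ^ (-(N : ℝ) / 2) * heatKernel σ z := by
  unfold heatKernel
  rw [norm_smul, mul_pow, Real.norm_of_nonneg (Real.sqrt_nonneg t), Real.sq_sqrt ht.le,
    show 4 * Real.pi * (t * σ) = t * (4 * Real.pi * σ) by ring,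
    Real.mul_rpow ht.le (by positivity), mul_assoc]
  congr 3
  rw [show 4 * (t * σ) = t * (4 * σ) by ring, neg_mul_eq_mul_neg, mul_div_mul_left _ _ ht.ne']

/-- The substitution x = √t z turns t → ∞ into convergence of the time 1 - s/t to 1 and of the shift
y/√t to 0. -/
theorem integral_abs_heatKernel_sub_sub {s t : ℝ} (ht : 0 < t) (hst : s < t)
    (y : EuclideanSpace ℝ (Fin N)) :
    ∫ x, |heatKernel (t - s) (x - y) - heatKernel t x| =
      ∫ z, |heatKernel (1 - s / t) (z - (Real.sqrt t)⁻¹ • y) - heatKernel 1 z| := by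
  have hs : 0 < Real.sqrt t := Real.sqrt_pos.2 ht
  have hσ : 0 ≤ 1 - s / t := by rw [sub_nonneg, div_le_one ht]; exact hst.le
  have h := Measure.integral_comp_smul_of_nonneg volume
    (fun x => |heatKernel (t - s) (x - y) - heatKernel t x|) (Real.sqrt t) (hR := hs.le)
  have e : ∀ z : EuclideanSpace ℝ (Fin N),
      |heatKernel (t - s) (Real.sqrt t • z - y) - heatKernel t (Real.sqrt t • z)| =
      t ^ (-(N : ℝ) / 2) *
        |heatKernel (1 - s / t) (z - (Real.sqrt t)⁻¹ • y) - heatKernel 1 z| := by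
    intro z
    have h1 := heatKernel_mul_sqrt_smul ht hσ (z - (Real.sqrt t)⁻¹ • y)
    have h2 := heatKernel_mul_sqrt_smul ht zero_le_one z
    rw [mul_one] at h2
    rw [smul_sub, smul_inv_smul₀ hs.ne', mul_sub, mul_one, mul_div_cancel₀ _ ht.ne'] at h1
    rw [h1, h2, ← mul_sub, abs_mul, abs_of_nonneg (Real.rpow_nonneg ht.le _)]
  simp_rw [e] at h
  rw [integral_const_mul, finrank_euclideanSpace_fin, smul_eq_mul] at h
  have e2 : t ^ (-(N : ℝ) / 2) = (Real.sqrt t ^ N)⁻¹ := by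
    rw [neg_div, Real.rpow_neg ht.le, Real.sqrt_eq_rpow, ← Real.rpow_natCast, ← Real.rpow_mul ht.le]
    congr 2; ring
  rw [e2] at h
  exact (mul_left_cancel₀ (inv_ne_zero (pow_ne_zero _ hs.ne')) h).symm

/-- An integrable majorant, uniform near (σ, η) = (1, 0). From |z|² ≤ 2|z-η|² + 2 the exponent
satisfies -|z-η|²/(4σ) ≤ 1/4 - |z|²/8, and σ ≥ 1/2 controls the prefactor. -/
theorem heatKernel_sub_le {σ : ℝ} (h0 : 1 / 2 ≤ σ) (h1 : σ ≤ 1)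
    {η : EuclideanSpace ℝ (Fin N)} (hη : ‖η‖ ≤ 1) (z : EuclideanSpace ℝ (Fin N)) :
    heatKernel σ (z - η) ≤
      (2 * Real.pi) ^ (-(N : ℝ) / 2) * Real.exp (1 / 4) * (8 * Real.pi) ^ ((N : ℝ) / 2) *
        heatKernel 2 z := by
  have e : (8 * Real.pi) ^ ((N : ℝ) / 2) * (8 * Real.pi) ^ (-(N : ℝ) / 2) = 1 := by
    rw [← Real.rpow_add (by positivity)]; ring_nf; simp
  have e2 : (2 * Real.pi) ^ (-(N : ℝ) / 2) * Real.exp (1 / 4) * (8 * Real.pi) ^ ((N : ℝ) / 2) *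
      heatKernel 2 z = (2 * Real.pi) ^ (-(N : ℝ) / 2) *
        (Real.exp (1 / 4) * Real.exp (-‖z‖ ^ 2 / 8)) := by
    rw [heatKernel, show 4 * Real.pi * 2 = 8 * Real.pi by ring, show (4 * 2 : ℝ) = 8 by norm_num]
    linear_combination ((2 * Real.pi) ^ (-(N : ℝ) / 2) * Real.exp (1 / 4) *
      Real.exp (-‖z‖ ^ 2 / 8)) * e
  rw [e2, heatKernel, ← Real.exp_add]
  have hz : ‖z‖ ^ 2 ≤ 2 * ‖z - η‖ ^ 2 + 2 := by
    have h2 : ‖z‖ ≤ ‖z - η‖ + 1 := by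
      have := norm_add_le (z - η) η
      rw [sub_add_cancel] at this
      linarith
    nlinarith [norm_nonneg z, sq_nonneg (‖z - η‖ - 1), norm_nonneg (z - η)]
  have hσ : 0 < σ := by linarith
  gcongr ?_ * ?_
  · exact Real.rpow_le_rpow_of_nonpos (by positivity) (by nlinarith [Real.pi_pos])
      (by rw [neg_div]; exact neg_nonpos.2 (by positivity))
  · refine Real.exp_le_exp.2 ?_
    rw [neg_div, neg_div]
    have : ‖z - η‖ ^ 2 / 4 ≤ ‖z - η‖ ^ 2 / (4 * σ) := by gcongr; linarith
    linarith

/-- After rescaling, the integrand tends to 0 pointwise by joint continuity of the kernel at time 1,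
under the Gaussian majorant above. -/
theorem tendsto_lintegral_heatKernel_sub_sub {s : ℝ} (hs : 0 ≤ s)
    (y : EuclideanSpace ℝ (Fin N)) :
    Tendsto (fun t : ℝ => ∫⁻ x, ‖heatKernel (t - s) (x - y) - heatKernel t x‖ₑ)
      atTop (𝓝 0) := by
  have hst : Tendsto (fun t : ℝ => s / t) atTop (𝓝 0) := tendsto_const_nhds.div_atTop tendsto_id
  have hη : Tendsto (fun t : ℝ => (Real.sqrt t)⁻¹ • y) atTop (𝓝 0) := by
    simpa using (tendsto_inv_atTop_zero.comp Real.tendsto_sqrt_atTop).smul_const y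
  have key : Tendsto (fun t : ℝ => ∫ z : EuclideanSpace ℝ (Fin N),
      |heatKernel (1 - s / t) (z - (Real.sqrt t)⁻¹ • y) - heatKernel 1 z|) atTop (𝓝 0) := by
    have h0 : (0 : ℝ) = ∫ _z : EuclideanSpace ℝ (Fin N), (0 : ℝ) := by simp
    rw [h0]
    refine tendsto_integral_filter_of_dominated_convergence
      (fun z => (2 * Real.pi) ^ (-(N : ℝ) / 2) * Real.exp (1 / 4) * (8 * Real.pi) ^ ((N : ℝ) / 2) *
        heatKernel 2 z + heatKernel 1 z) ?_ ?_ ?_ ?_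
    · refine Eventually.of_forall fun t => Continuous.aestronglyMeasurable ?_
      have h1 := continuous_heatKernel (N := N) (1 - s / t)
      have h2 := continuous_heatKernel (N := N) 1
      fun_prop
    · filter_upwards [hst.eventually (ge_mem_nhds (show (0 : ℝ) < 1 / 2 by norm_num)),
        eventually_gt_atTop 0,
        (hη.norm.eventually (ge_mem_nhds (show ‖(0 : EuclideanSpace ℝ (Fin N))‖ < 1 by simp)))]
        with t h1 h2 h3
      refine Eventually.of_forall fun z => ?_
      have h4 : 0 ≤ s / t := by positivity
      rw [Real.norm_eq_abs, abs_abs]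
      refine (abs_sub _ _).trans ?_
      rw [abs_of_nonneg (heatKernel_nonneg (by linarith) _),
        abs_of_nonneg (heatKernel_nonneg zero_le_one _)]
      gcongr
      exact heatKernel_sub_le (by linarith) (by linarith) h3 z
    · exact ((integrable_heatKernel two_pos).const_mul _).add (integrable_heatKernel one_pos)
    · refine Eventually.of_forall fun z => ?_
      have h1 : ContinuousAt (fun q : ℝ × EuclideanSpace ℝ (Fin N) => heatKernel q.1 q.2) (1, z) := by
        unfold heatKernel
        have h5 : ContinuousAt (fun q : ℝ × EuclideanSpace ℝ (Fin N) =>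
            (4 * Real.pi * q.1) ^ (-(N : ℝ) / 2)) (1, z) :=
          ContinuousAt.rpow_const (by fun_prop) (Or.inl (by simp [Real.pi_ne_zero]))
        refine h5.mul (Real.continuous_exp.continuousAt.comp ?_)
        exact ContinuousAt.div (by fun_prop) (by fun_prop) (by norm_num)
      have h2 : Tendsto (fun t : ℝ => ((1 - s / t, z - (Real.sqrt t)⁻¹ • y) :
          ℝ × EuclideanSpace ℝ (Fin N))) atTop (𝓝 (1, z)) := by
        simpa using (tendsto_const_nhds.sub hst).prodMk_nhds
          ((tendsto_const_nhds (x := z)).sub hη)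
      have h3 := (h1.tendsto.comp h2).sub_const (heatKernel 1 z)
      simpa using h3.abs
  rw [← ENNReal.ofReal_zero]
  refine (ENNReal.tendsto_ofReal key).congr' ?_
  filter_upwards [eventually_gt_atTop 0, eventually_gt_atTop s] with t ht hlt
  rw [← integral_abs_heatKernel_sub_sub ht hlt]
  have hint : Integrable fun x : EuclideanSpace ℝ (Fin N) =>
      heatKernel (t - s) (x - y) - heatKernel t x :=
    ((integrable_heatKernel (sub_pos.2 hlt)).comp_sub_right y).sub (integrable_heatKernel ht)
  exact ofReal_integral_norm_eq_lintegral_enorm hint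

end HeatKernelShift

/-! ### Plane waves and their approximation by test functions -/

section PlaneWaves

variable {E : Type*} [NormedAddCommGroup E] [InnerProductSpace ℝ E]

theorem contDiff_cos_inner_add (ξ : E) (θ : ℝ) :
    ContDiff ℝ ∞ fun x : E => Real.cos (inner ℝ ξ x + θ) :=
  Real.contDiff_cos.comp ((contDiff_const.inner ℝ contDiff_id).add contDiff_const)

theorem iteratedFDeriv_cos_inner_add (ξ : E) (θ : ℝ) (k : ℕ) (x : E) :
    iteratedFDeriv ℝ k (fun x : E => Real.cos (inner ℝ ξ x + θ)) x =
      (iteratedFDeriv ℝ k (fun r : ℝ => Real.cos (r + θ)) (inner ℝ ξ x)).compContinuousLinearMap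
        fun _ => innerSL ℝ ξ :=
  (innerSL ℝ ξ).iteratedFDeriv_comp_right (f := fun r : ℝ => Real.cos (r + θ)) (n := ∞)
    (by fun_prop) x (by exact_mod_cast le_top)

theorem norm_iteratedFDeriv_cos_inner_add_le (ξ : E) (θ : ℝ) (k : ℕ) (x : E) :
    ‖iteratedFDeriv ℝ k (fun x : E => Real.cos (inner ℝ ξ x + θ)) x‖ ≤ ‖ξ‖ ^ k := by
  rw [iteratedFDeriv_cos_inner_add]
  refine (ContinuousMultilinearMap.norm_compContinuousLinearMap_le _ _).trans ?_
  rw [norm_iteratedFDeriv_eq_norm_iteratedDeriv, iteratedDeriv_comp_add_const]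
  simp only [innerSL_apply_norm, Finset.prod_const, Finset.card_univ, Fintype.card_fin]
  exact mul_le_of_le_one_left (by positivity) (Real.abs_iteratedDeriv_cos_le_one k _)

/-- Each derivative of a dilated cutoff brings out a factor c, so dilations with |c| ≤ 1 have
derivative bounds independent of c. -/
theorem exists_norm_iteratedFDeriv_comp_smul_le {χ : E → ℝ} (hχ : ContDiff ℝ ∞ χ)
    (hs : HasCompactSupport χ) (k : ℕ) :
    ∃ C : ℝ, 0 ≤ C ∧ ∀ c : ℝ, |c| ≤ 1 → ∀ x,
      ‖iteratedFDeriv ℝ k (fun x => χ (c • x)) x‖ ≤ C := by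
  obtain ⟨C, hC⟩ := (hs.iteratedFDeriv (𝕜 := ℝ) k).exists_bound_of_continuous
    (hχ.continuous_iteratedFDeriv (m := k) (by exact_mod_cast le_top))
  have hC0 : 0 ≤ C := (norm_nonneg _).trans (hC 0)
  refine ⟨C, hC0, fun c hc x => ?_⟩
  have := (c • ContinuousLinearMap.id ℝ E).iteratedFDeriv_comp_right hχ x (i := k)
    (by exact_mod_cast le_top)
  change ‖iteratedFDeriv ℝ k (χ ∘ (c • ContinuousLinearMap.id ℝ E)) x‖ ≤ C
  rw [this]
  refine (ContinuousMultilinearMap.norm_compContinuousLinearMap_le _ _).trans ?_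
  simp only [Finset.prod_const, Finset.card_univ, Fintype.card_fin]
  refine (mul_le_of_le_one_right (norm_nonneg _) (pow_le_one₀ (norm_nonneg _) ?_)).trans (hC _)
  rw [norm_smul]
  exact mul_le_one₀ hc (norm_nonneg _) ContinuousLinearMap.norm_id_le

variable [FiniteDimensional ℝ E]

theorem laplacian_cos_inner_add (ξ : E) (θ : ℝ) (x : E) :
    Laplacian.laplacian (fun x : E => Real.cos (inner ℝ ξ x + θ)) x =
      -‖ξ‖ ^ 2 * Real.cos (inner ℝ ξ x + θ) := by
  rw [InnerProductSpace.laplacian_eq_iteratedFDeriv_stdOrthonormalBasis]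
  simp only [iteratedFDeriv_cos_inner_add, ContinuousMultilinearMap.compContinuousLinearMap_apply,
    iteratedFDeriv_apply_eq_iteratedDeriv_mul_prod, iteratedDeriv_comp_add_const]
  rw [← (stdOrthonormalBasis ℝ E).sum_sq_norm_inner_left ξ, ← Finset.sum_neg_distrib,
    Finset.sum_mul]
  refine Finset.sum_congr rfl fun i _ => ?_
  simp only [Fin.prod_univ_two, Matrix.cons_val_zero, Matrix.cons_val_one, innerSL_apply_apply,
    Real.norm_eq_abs, sq_abs, smul_eq_mul]
  simp
  ring_nf
  simp

theorem abs_laplacian_le {φ : E → ℝ} {x : E} :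
    |Laplacian.laplacian φ x| ≤ Module.finrank ℝ E * ‖iteratedFDeriv ℝ 2 φ x‖ := by
  rw [InnerProductSpace.laplacian_eq_iteratedFDeriv_stdOrthonormalBasis]
  refine (Finset.abs_sum_le_sum_abs _ _).trans ?_
  refine (Finset.sum_le_card_nsmul _ _ ‖iteratedFDeriv ℝ 2 φ x‖ fun i _ => ?_).trans
    (le_of_eq (by simp))
  refine ((iteratedFDeriv ℝ 2 φ x).le_opNorm _).trans ?_
  simp [Fin.prod_univ_two]

theorem continuous_laplacian {φ : E → ℝ} (hφ : ContDiff ℝ ∞ φ) :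
    Continuous (Laplacian.laplacian φ) := by
  rw [InnerProductSpace.laplacian_eq_iteratedFDeriv_stdOrthonormalBasis]
  refine continuous_finsetSum _ fun i _ => ?_
  have h : ∀ k : ℕ, Continuous fun x => iteratedFDeriv ℝ k φ x := fun k =>
    hφ.continuous_iteratedFDeriv (m := k) (by exact_mod_cast le_top)
  have := h 2
  fun_prop

/-- Plane waves are locally uniform limits of test functions, with bounded Laplacians. -/
theorem exists_seq_testFunction_tendsto_cos (ξ : E) (θ : ℝ) :
    ∃ (φ : ℕ → E → ℝ) (C : ℝ), 0 ≤ C ∧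
      (∀ n, ContDiff ℝ ∞ (φ n)) ∧ (∀ n, HasCompactSupport (φ n)) ∧
      (∀ n x, |φ n x| ≤ C) ∧ (∀ n x, |Laplacian.laplacian (φ n) x| ≤ C) ∧
      (∀ x, ∀ᶠ n in atTop, φ n =ᶠ[𝓝 x] fun x => Real.cos (inner ℝ ξ x + θ)) := by
  -- A cutoff equal to 1 on the unit ball, dilated by c = 1/(n+1) so that it equals 1 on the ball of
  -- radius n+1.
  let χ : ContDiffBump (0 : E) := ⟨1, 2, one_pos, one_lt_two⟩
  have hχ : ContDiff ℝ ∞ χ := χ.contDiff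
  have hχs : HasCompactSupport χ := χ.hasCompactSupport
  choose B hB0 hB using exists_norm_iteratedFDeriv_comp_smul_le hχ hχs
  let c : ℕ → ℝ := fun n => ((n : ℝ) + 1)⁻¹
  have hc0 : ∀ n, 0 < c n := fun n => by positivity
  have hc1 : ∀ n, |c n| ≤ 1 := fun n => by
    rw [abs_of_pos (hc0 n)]
    exact inv_le_one_of_one_le₀ (by simp)
  have hsm : ∀ n, ContDiff ℝ ∞ fun x => χ (c n • x) := fun n =>
    hχ.comp (contDiff_id.const_smul _)
  have hD : ∀ k n x, ‖iteratedFDeriv ℝ k (fun x => χ (c n • x) * Real.cos (inner ℝ ξ x + θ)) x‖ ≤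
      ∑ i ∈ Finset.range (k + 1), (k.choose i : ℝ) * B i * ‖ξ‖ ^ (k - i) := by
    intro k n x
    refine (norm_iteratedFDeriv_mul_le (hsm n) (contDiff_cos_inner_add ξ θ) x
      (n := k) (by exact_mod_cast le_top)).trans (Finset.sum_le_sum fun i _ => ?_)
    gcongr
    · exact mul_nonneg (by positivity) (hB0 i)
    · exact hB i _ (hc1 n) x
    · exact norm_iteratedFDeriv_cos_inner_add_le ξ θ _ x
  set D : ℕ → ℝ := fun k => ∑ i ∈ Finset.range (k + 1), (k.choose i : ℝ) * B i * ‖ξ‖ ^ (k - i)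
  have hD0 : ∀ k, 0 ≤ D k := fun k => (norm_nonneg _).trans (hD k 0 0)
  -- The constant is the sum of D 0, bounding the functions, and of dim E times D 2, bounding their
  -- Laplacians.
  refine ⟨fun n x => χ (c n • x) * Real.cos (inner ℝ ξ x + θ),
    D 0 + Module.finrank ℝ E * D 2, add_nonneg (hD0 0) (mul_nonneg (by positivity) (hD0 2)),
    fun n => (hsm n).mul (contDiff_cos_inner_add ξ θ), fun n => ?_, fun n x => ?_, fun n x => ?_,
    fun x => ?_⟩
  · exact HasCompactSupport.mul_right
      (hχs.comp_homeomorph (Homeomorph.smulOfNeZero (c n) (hc0 n).ne'))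
  · have := hD 0 n x
    rw [norm_iteratedFDeriv_zero] at this
    exact this.trans (le_add_of_nonneg_right (mul_nonneg (by positivity) (hD0 2)))
  · refine (abs_laplacian_le.trans ?_).trans (le_add_of_nonneg_left (hD0 0))
    gcongr
    exact hD 2 n x
  · obtain ⟨m, hm⟩ := exists_nat_gt ‖x‖
    filter_upwards [eventually_ge_atTop m] with n hn
    have hx : ‖x‖ < n + 1 := by
      have : (m : ℝ) ≤ n := by exact_mod_cast hn
      linarith
    filter_upwards [continuous_norm.continuousAt.eventually (gt_mem_nhds hx)] with y hy
    have : χ (c n • y) = 1 := by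
      refine χ.one_of_mem_closedBall ?_
      rw [mem_closedBall_zero_iff, norm_smul, Real.norm_of_nonneg (hc0 n).le]
      change ((n : ℝ) + 1)⁻¹ * ‖y‖ ≤ 1
      rw [inv_mul_le_one₀ (by positivity)]
      exact hy.le
    rw [this, one_mul]

end PlaneWaves

/-! ### Extension of the weak formulation to plane waves -/

section WeakFormulation

variable {N : ℕ} {u₀ : EuclideanSpace ℝ (Fin N) → ℝ} {f u : ℝ → EuclideanSpace ℝ (Fin N) → ℝ}

theorem IsHeatSolution.continuousOn_integral_mul (hu : IsHeatSolution u₀ f u)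
    {ψ : EuclideanSpace ℝ (Fin N) → ℝ} (hψ : Continuous ψ) {C : ℝ} (hC : ∀ x, |ψ x| ≤ C) :
    ContinuousOn (fun s => ∫ x, u s x * ψ x) (Ici 0) := by
  have hint : ∀ s, 0 ≤ s → Integrable (fun x => u s x * ψ x) := fun s hs =>
    (hu.integrable s hs).mul_bdd (c := C) hψ.aestronglyMeasurable (Eventually.of_forall hC)
  intro t ht
  refine tendsto_integral_of_L1' _ (hint t ht).aestronglyMeasurable ?_ ?_
  · filter_upwards [self_mem_nhdsWithin] with s hs using hint s hs
  · have h := ENNReal.Tendsto.const_mul (a := ENNReal.ofReal C) (hu.continuous t ht)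
      (Or.inr ENNReal.ofReal_ne_top)
    rw [mul_zero] at h
    refine tendsto_of_tendsto_of_tendsto_of_le_of_le tendsto_const_nhds h (fun _ => zero_le)
      fun s => ?_
    refine eLpNorm_le_mul_eLpNorm_of_ae_le_mul (Eventually.of_forall fun x => ?_) 1
    rw [Pi.sub_apply, ← sub_mul, norm_mul, mul_comm]
    gcongr
    exact hC x

theorem IsHeatSolution.exists_integral_abs_le (hu : IsHeatSolution u₀ f u) (t : ℝ) :
    ∃ B : ℝ, ∀ s ∈ Icc 0 t, ∫ x, |u s x| ≤ B := by
  have hcont : ContinuousOn (fun s => ∫ x, |u s x|) (Ici 0) := by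
    intro t ht
    refine tendsto_integral_of_L1' _ (hu.integrable t ht).abs.aestronglyMeasurable ?_ ?_
    · filter_upwards [self_mem_nhdsWithin] with s hs using (hu.integrable s hs).abs
    · refine tendsto_of_tendsto_of_tendsto_of_le_of_le tendsto_const_nhds (hu.continuous t ht)
        (fun _ => zero_le) fun s => ?_
      exact eLpNorm_mono fun x => abs_abs_sub_abs_le_abs_sub _ _
  obtain ⟨B, hB⟩ := isCompact_Icc.bddAbove_image 
    (hcont.mono (Icc_subset_Ici_self : Icc 0 t ⊆ Ici 0))
  exact ⟨B, fun s hs => hB (mem_image_of_mem _ hs)⟩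

theorem integrable_integral_mul_of_bounded {S : Set ℝ}
    (hf : Integrable (fun z : ℝ × EuclideanSpace ℝ (Fin N) => f z.1 z.2)
      ((volume.restrict S).prod volume))
    {ψ : EuclideanSpace ℝ (Fin N) → ℝ} (hψ : Continuous ψ) {C : ℝ} (hC : ∀ x, |ψ x| ≤ C) :
    Integrable (fun s => ∫ x, f s x * ψ x) (volume.restrict S) := by
  have h : Integrable (fun z : ℝ × EuclideanSpace ℝ (Fin N) => f z.1 z.2 * ψ z.2)
      ((volume.restrict S).prod volume) :=
    hf.mul_bdd (c := C) (hψ.comp continuous_snd).aestronglyMeasurable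
      (Eventually.of_forall fun z => hC z.2)
  exact h.integral_prod_left

/-- The weak formulation holds for plane waves. -/
theorem IsHeatSolution.integral_mul_cos (hu : IsHeatSolution u₀ f u) (hu₀ : Integrable u₀ volume)
    (hf : Integrable (fun z : ℝ × EuclideanSpace ℝ (Fin N) => f z.1 z.2)
      ((volume.restrict (Ioi (0 : ℝ))).prod volume))
    (ξ : EuclideanSpace ℝ (Fin N)) (θ : ℝ) {t : ℝ} (ht : 0 ≤ t) :
    ∫ x, u t x * Real.cos (inner ℝ ξ x + θ) = (∫ x, u₀ x * Real.cos (inner ℝ ξ x + θ)) +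
      ∫ s in (0 : ℝ)..t, (-‖ξ‖ ^ 2 * (∫ x, u s x * Real.cos (inner ℝ ξ x + θ)) +
        ∫ x, f s x * Real.cos (inner ℝ ξ x + θ)) := by
  obtain ⟨φ, C, hC0, hsm, hcs, hφC, hΔC, hlim⟩ := exists_seq_testFunction_tendsto_cos ξ θ
  obtain ⟨B, hB⟩ := hu.exists_integral_abs_le t
  have hφx : ∀ x, Tendsto (fun n => φ n x) atTop (𝓝 (Real.cos (inner ℝ ξ x + θ))) := fun x =>
    tendsto_const_nhds.congr' ((hlim x).mono fun n hn => hn.eq_of_nhds.symm)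
  have hΔx : ∀ x, Tendsto (fun n => Laplacian.laplacian (φ n) x) atTop
      (𝓝 (-‖ξ‖ ^ 2 * Real.cos (inner ℝ ξ x + θ))) := fun x => by
    refine tendsto_const_nhds.congr' ((hlim x).mono fun n hn => ?_)
    rw [← laplacian_cos_inner_add]
    exact (InnerProductSpace.laplacian_congr_nhds hn).eq_of_nhds.symm
  -- Dominated convergence in x with majorant C|v|; it is used for the test functions as well as for
  -- their Laplacians.
  have hL : ∀ v : EuclideanSpace ℝ (Fin N) → ℝ, Integrable v →
      ∀ (g : ℕ → EuclideanSpace ℝ (Fin N) → ℝ) (g' : EuclideanSpace ℝ (Fin N) → ℝ),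
      (∀ n, Continuous (g n)) → (∀ n x, |g n x| ≤ C) →
      (∀ x, Tendsto (fun n => g n x) atTop (𝓝 (g' x))) →
      Tendsto (fun n => ∫ x, v x * g n x) atTop (𝓝 (∫ x, v x * g' x)) := by
    intro v hv g g' hg hgC hgl
    refine tendsto_integral_of_dominated_convergence (fun x => |v x| * C)
      (fun n => hv.aestronglyMeasurable.mul (hg n).aestronglyMeasurable) (hv.abs.mul_const C)
      (fun n => Eventually.of_forall fun x => ?_)
      (Eventually.of_forall fun x => (hgl x).const_mul (v x))
    rw [norm_mul]
    exact mul_le_mul_of_nonneg_left (hgC n x) (norm_nonneg _)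
  have hfi : ∀ᵐ s ∂(volume.restrict (Ioi (0 : ℝ))), Integrable (f s) := hf.prod_right_ae
  rw [ae_restrict_iff' measurableSet_Ioi] at hfi
  have hcφ : ∀ n, Continuous (φ n) := fun n => (hsm n).continuous
  have hcΔ : ∀ n, Continuous (Laplacian.laplacian (φ n)) := fun n => continuous_laplacian (hsm n)
  have hsub : uIoc 0 t ⊆ Ioi (0 : ℝ) := by
    rw [uIoc_of_le ht]; exact Ioc_subset_Ioi_self
  have hsub' : uIoc 0 t ⊆ Ici (0 : ℝ) := hsub.trans Ioi_subset_Ici_self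
  have hbd : ∀ (v : EuclideanSpace ℝ (Fin N) → ℝ) (g : EuclideanSpace ℝ (Fin N) → ℝ),
      Integrable v → (∀ x, |g x| ≤ C) → |∫ x, v x * g x| ≤ (∫ x, |v x|) * C := by
    intro v g hv hg
    rw [← integral_mul_const, ← Real.norm_eq_abs]
    refine norm_integral_le_of_norm_le (hv.abs.mul_const C) (Eventually.of_forall fun x => ?_)
    rw [norm_mul]
    exact mul_le_mul_of_nonneg_left (hg x) (norm_nonneg _)
  have hnorm : Integrable (fun s => ∫ x, |f s x|) (volume.restrict (Ioi (0 : ℝ))) :=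
    hf.norm.integral_prod_left
  have h1 := hL _ (hu.integrable t ht) _ _ hcφ hφC hφx
  have h2 := hL _ hu₀ _ _ hcφ hφC hφx
  have h3 : Tendsto (fun n => ∫ s in (0 : ℝ)..t,
      ((∫ x, u s x * Laplacian.laplacian (φ n) x) + ∫ x, f s x * φ n x)) atTop
      (𝓝 (∫ s in (0 : ℝ)..t, (-‖ξ‖ ^ 2 * (∫ x, u s x * Real.cos (inner ℝ ξ x + θ)) +
        ∫ x, f s x * Real.cos (inner ℝ ξ x + θ)))) := by
    -- Dominated convergence in s: B bounds ‖u(s)‖₁ on [0, t], and ‖f(s)‖₁ is integrable in s.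
    refine intervalIntegral.tendsto_integral_filter_of_dominated_convergence
      (fun s => B * C + (∫ x, |f s x|) * C) (Eventually.of_forall fun n => ?_)
      (Eventually.of_forall fun n => ?_) ?_ ?_
    · refine AEStronglyMeasurable.add ?_ ?_
      · exact ((hu.continuousOn_integral_mul (hcΔ n) (hΔC n)).mono hsub').aestronglyMeasurable
          measurableSet_uIoc
      · exact ((integrable_integral_mul_of_bounded hf (hcφ n) (hφC n)).mono_measure
          (Measure.restrict_mono hsub le_rfl)).aestronglyMeasurable
    · filter_upwards [hfi] with s hs hmem
      have hs0 : 0 < s := hsub hmem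
      have hsI : s ∈ Icc 0 t := by
        rw [uIoc_of_le ht] at hmem; exact Ioc_subset_Icc_self hmem
      refine (norm_add_le _ _).trans (add_le_add ?_ (hbd _ _ (hs hs0) (hφC n)))
      refine (hbd _ _ (hu.integrable s hs0.le) (hΔC n)).trans ?_
      gcongr
      exact hB s hsI
    · refine (intervalIntegrable_const).add ?_
      rw [intervalIntegrable_iff]
      exact (hnorm.mono_measure (Measure.restrict_mono hsub le_rfl)).mul_const C
    · filter_upwards [hfi] with s hs hmem
      have hs0 : 0 < s := hsub hmem
      refine Tendsto.add ?_ (hL _ (hs hs0) _ _ hcφ hφC hφx)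
      have := hL _ (hu.integrable s hs0.le) _ _ hcΔ hΔC hΔx
      simp_rw [mul_left_comm (u s _), integral_const_mul] at this
      exact this
  refine tendsto_nhds_unique h1 ?_
  simp_rw [fun n => hu.weak (φ n) (hsm n) (hcs n) t ht]
  exact h2.add h3

theorem intervalIntegrable_integral_mul_of_bounded
    (hf : Integrable (fun z : ℝ × EuclideanSpace ℝ (Fin N) => f z.1 z.2)
      ((volume.restrict (Ioi (0 : ℝ))).prod volume))
    {ψ : EuclideanSpace ℝ (Fin N) → ℝ} (hψ : Continuous ψ) {C : ℝ} (hC : ∀ x, |ψ x| ≤ C)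
    {a b : ℝ} (ha : 0 ≤ a) (hab : a ≤ b) :
    IntervalIntegrable (fun s => ∫ x, f s x * ψ x) volume a b := by
  rw [intervalIntegrable_iff, uIoc_of_le hab]
  exact (integrable_integral_mul_of_bounded hf hψ hC).mono_measure
    (Measure.restrict_mono (fun s hs => ha.trans_lt hs.1) le_rfl)

/-- Duhamel's formula tested against plane waves. -/
theorem IsHeatSolution.integral_mul_cos_eq_duhamel (hu : IsHeatSolution u₀ f u)
    (hu₀ : Integrable u₀ volume)
    (hf : Integrable (fun z : ℝ × EuclideanSpace ℝ (Fin N) => f z.1 z.2)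
      ((volume.restrict (Ioi (0 : ℝ))).prod volume))
    (ξ : EuclideanSpace ℝ (Fin N)) (θ : ℝ) {τ t : ℝ} (hτ : 0 ≤ τ) (hτt : τ ≤ t) :
    ∫ x, u t x * Real.cos (inner ℝ ξ x + θ) =
      Real.exp (-‖ξ‖ ^ 2 * (t - τ)) * (∫ x, u τ x * Real.cos (inner ℝ ξ x + θ)) +
      ∫ s in τ..t, Real.exp (-‖ξ‖ ^ 2 * (t - s)) *
        ∫ x, f s x * Real.cos (inner ℝ ξ x + θ) := by
  have hcos : Continuous fun x : EuclideanSpace ℝ (Fin N) => Real.cos (inner ℝ ξ x + θ) :=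
    (contDiff_cos_inner_add ξ θ).continuous
  have hbd : ∀ x : EuclideanSpace ℝ (Fin N), |Real.cos (inner ℝ ξ x + θ)| ≤ 1 :=
    fun x => Real.abs_cos_le_one _
  have hF : ∀ {a b : ℝ}, 0 ≤ a → a ≤ b → IntervalIntegrable
      (fun s => ∫ x, f s x * Real.cos (inner ℝ ξ x + θ)) volume a b := fun ha hab =>
    intervalIntegrable_integral_mul_of_bounded hf hcos hbd ha hab
  have hc : ∀ {a b : ℝ}, 0 ≤ a → a ≤ b → IntervalIntegrable
      (fun s => ∫ x, u s x * Real.cos (inner ℝ ξ x + θ)) volume a b := fun ha hab => by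
    refine ContinuousOn.intervalIntegrable
      ((hu.continuousOn_integral_mul hcos hbd).mono fun s hs => ?_)
    rw [uIcc_of_le hab] at hs
    exact ha.trans hs.1
  refine eq_exp_mul_add_integral_of_integral_eq hτt (hF hτ hτt) (hc hτ hτt) fun s hs => ?_
  have h0 : ∀ {a b : ℝ}, 0 ≤ a → a ≤ b → IntervalIntegrable
      (fun s => -‖ξ‖ ^ 2 * (∫ x, u s x * Real.cos (inner ℝ ξ x + θ)) +
        ∫ x, f s x * Real.cos (inner ℝ ξ x + θ)) volume a b := fun ha hab =>
    ((hc ha hab).const_mul _).add (hF ha hab)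
  have h1 := hu.integral_mul_cos hu₀ hf ξ θ hτ
  have h2 := hu.integral_mul_cos hu₀ hf ξ θ (hτ.trans hs.1)
  -- Subtracting the identity at τ from the one at s restarts the equation at time τ.
  rw [← intervalIntegral.integral_add_adjacent_intervals (h0 le_rfl hτ) (h0 hτ hs.1)] at h2
  linarith

end WeakFormulation

/-! ### Fubini for superpositions of kernels -/

section Superposition

variable {X Z : Type*} [MeasurableSpace X] [MeasurableSpace Z] {μ : Measure X} {ν : Measure Z}

theorem lintegral_lintegral_enorm_mul_le [SFinite μ] [SFinite ν] {k : X → Z → ℝ} {h : Z → ℝ}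
    (hk : AEStronglyMeasurable (Function.uncurry k) (μ.prod ν)) (hh : AEStronglyMeasurable h ν) :
    ∫⁻ x, ∫⁻ z, ‖k x z * h z‖ₑ ∂ν ∂μ ≤ ∫⁻ z, (∫⁻ x, ‖k x z‖ₑ ∂μ) * ‖h z‖ₑ ∂ν := by
  have hm : AEStronglyMeasurable (Function.uncurry fun x z => k x z * h z) (μ.prod ν) :=
    hk.mul hh.comp_snd
  rw [lintegral_lintegral_swap hm.enorm]
  refine lintegral_mono fun z => ?_
  simp_rw [enorm_mul]
  rw [lintegral_mul_const' _ _ enorm_ne_top]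

theorem integrable_prod_mul_of_lintegral_le [SFinite μ] [SFinite ν] {k : X → Z → ℝ} {h : Z → ℝ}
    (hk : AEStronglyMeasurable (Function.uncurry k) (μ.prod ν)) (hh : Integrable h ν)
    {C : ℝ≥0∞} (hC : C ≠ ⊤) (hb : ∀ᵐ z ∂ν, ∫⁻ x, ‖k x z‖ₑ ∂μ ≤ C) :
    Integrable (Function.uncurry fun x z => k x z * h z) (μ.prod ν) := by
  have hm : AEStronglyMeasurable (Function.uncurry fun x z => k x z * h z) (μ.prod ν) :=
    hk.mul hh.aestronglyMeasurable.comp_snd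
  refine ⟨hm, ?_⟩
  rw [hasFiniteIntegral_iff_enorm, lintegral_prod _ hm.enorm]
  refine (lintegral_lintegral_enorm_mul_le hk hh.aestronglyMeasurable).trans_lt ?_
  calc ∫⁻ z, (∫⁻ x, ‖k x z‖ₑ ∂μ) * ‖h z‖ₑ ∂ν ≤ ∫⁻ z, C * ‖h z‖ₑ ∂ν := by
        refine lintegral_mono_ae (hb.mono fun z hz => ?_)
        gcongr
    _ = C * ∫⁻ z, ‖h z‖ₑ ∂ν := lintegral_const_mul' _ _ hC
    _ < ⊤ := ENNReal.mul_lt_top hC.lt_top hh.2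

theorem integral_superposition_mul [SFinite μ] [SFinite ν] {k : X → Z → ℝ} {h : Z → ℝ}
    (hkh : Integrable (Function.uncurry fun x z => k x z * h z) (μ.prod ν))
    {φ : X → ℝ} (hφ : AEStronglyMeasurable φ μ) {C : ℝ} (hC : ∀ x, |φ x| ≤ C) :
    ∫ x, (∫ z, k x z * h z ∂ν) * φ x ∂μ = ∫ z, h z * ∫ x, k x z * φ x ∂μ ∂ν := by
  have hint : Integrable (Function.uncurry fun x z => k x z * h z * φ x) (μ.prod ν) :=
    hkh.mul_bdd (c := C) hφ.comp_fst (Eventually.of_forall fun q => hC q.1)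
  simp_rw [← integral_mul_const, ← integral_const_mul]
  rw [integral_integral_swap hint]
  refine integral_congr_ae (Eventually.of_forall fun z => integral_congr_ae
    (Eventually.of_forall fun x => ?_))
  simp only
  ring

end Superposition

/-! ### Duhamel's formula -/

section Duhamel

variable {N : ℕ}

/-- The solution `G(t) * w` of the heat equation with initial value `w`. -/
noncomputable def heatEvolution (t : ℝ) (w : EuclideanSpace ℝ (Fin N) → ℝ)
    (x : EuclideanSpace ℝ (Fin N)) : ℝ :=
  ∫ y, heatKernel t (x - y) * w y

/-- The contribution at time `t` of the source `f` acting during the time interval `(τ, t)`. -/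
noncomputable def heatSource (τ t : ℝ) (f : ℝ → EuclideanSpace ℝ (Fin N) → ℝ)
    (x : EuclideanSpace ℝ (Fin N)) : ℝ :=
  ∫ z : ℝ × EuclideanSpace ℝ (Fin N), heatKernel (t - z.1) (x - z.2) * f z.1 z.2
    ∂((volume.restrict (Ioo τ t)).prod volume)

variable {u₀ : EuclideanSpace ℝ (Fin N) → ℝ} {f u : ℝ → EuclideanSpace ℝ (Fin N) → ℝ}

theorem measurable_heatKernel_sub (t : ℝ) :
    Measurable (Function.uncurry fun (x : EuclideanSpace ℝ (Fin N))
      (y : EuclideanSpace ℝ (Fin N)) => heatKernel t (x - y)) :=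
  (continuous_heatKernel t).measurable.comp (measurable_fst.sub measurable_snd)

theorem measurable_heatKernel_sub_sub (t : ℝ) :
    Measurable (Function.uncurry fun (x : EuclideanSpace ℝ (Fin N))
      (z : ℝ × EuclideanSpace ℝ (Fin N)) => heatKernel (t - z.1) (x - z.2)) :=
  measurable_heatKernel_uncurry.comp
    ((measurable_const.sub (measurable_fst.comp measurable_snd)).prodMk
      (measurable_fst.sub (measurable_snd.comp measurable_snd)))

theorem lintegral_enorm_heatKernel_sub {t : ℝ} (ht : 0 < t) (y : EuclideanSpace ℝ (Fin N)) :
    ∫⁻ x, ‖heatKernel t (x - y)‖ₑ = 1 := by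
  rw [lintegral_sub_right_eq_self (fun x => ‖heatKernel t x‖ₑ) y, lintegral_enorm_heatKernel ht]

theorem integrable_heatEvolution_prod {t : ℝ} (ht : 0 < t) {w : EuclideanSpace ℝ (Fin N) → ℝ}
    (hw : Integrable w) :
    Integrable (Function.uncurry fun x y => heatKernel t (x - y) * w y)
      (volume.prod volume) :=
  integrable_prod_mul_of_lintegral_le (measurable_heatKernel_sub t).aestronglyMeasurable hw
    ENNReal.one_ne_top (Eventually.of_forall fun y => (lintegral_enorm_heatKernel_sub ht y).le)

theorem integrable_heatEvolution {t : ℝ} (ht : 0 < t) {w : EuclideanSpace ℝ (Fin N) → ℝ}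
    (hw : Integrable w) : Integrable (heatEvolution t w) :=
  (integrable_heatEvolution_prod ht hw).integral_prod_left

/-- By Fubini, convolution with G(t) acts on plane waves as the Fourier multiplier e^{-|ξ|²t}. -/
theorem integral_heatEvolution_mul_cos {t : ℝ} (ht : 0 < t) {w : EuclideanSpace ℝ (Fin N) → ℝ}
    (hw : Integrable w) (ξ : EuclideanSpace ℝ (Fin N)) (θ : ℝ) :
    ∫ x, heatEvolution t w x * Real.cos (inner ℝ ξ x + θ) =
      Real.exp (-‖ξ‖ ^ 2 * t) * ∫ x, w x * Real.cos (inner ℝ ξ x + θ) := by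
  unfold heatEvolution
  rw [integral_superposition_mul (integrable_heatEvolution_prod ht hw)
    (contDiff_cos_inner_add ξ θ).continuous.aestronglyMeasurable (fun x => Real.abs_cos_le_one _)]
  simp_rw [integral_heatKernel_sub_mul_cos ht, mul_left_comm (w _)]
  rw [integral_const_mul]

theorem ae_fst_mem_Ioo (τ t : ℝ) : ∀ᵐ z : ℝ × EuclideanSpace ℝ (Fin N)
    ∂((volume.restrict (Ioo τ t)).prod volume), z.1 ∈ Ioo τ t :=
  Measure.quasiMeasurePreserving_fst.ae (ae_restrict_mem measurableSet_Ioo)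

theorem integrable_heatSource_prod {τ t : ℝ}
    (hf : Integrable (fun z : ℝ × EuclideanSpace ℝ (Fin N) => f z.1 z.2)
      ((volume.restrict (Ioo τ t)).prod volume)) :
    Integrable (Function.uncurry fun (x : EuclideanSpace ℝ (Fin N))
      (z : ℝ × EuclideanSpace ℝ (Fin N)) => heatKernel (t - z.1) (x - z.2) * f z.1 z.2)
      (volume.prod ((volume.restrict (Ioo τ t)).prod volume)) :=
  integrable_prod_mul_of_lintegral_le (measurable_heatKernel_sub_sub t).aestronglyMeasurable hf
    ENNReal.one_ne_top ((ae_fst_mem_Ioo τ t).mono fun z hz =>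
      (lintegral_enorm_heatKernel_sub (sub_pos.2 hz.2) z.2).le)

theorem integrable_heatSource {τ t : ℝ}
    (hf : Integrable (fun z : ℝ × EuclideanSpace ℝ (Fin N) => f z.1 z.2)
      ((volume.restrict (Ioo τ t)).prod volume)) : Integrable (heatSource τ t f) :=
  (integrable_heatSource_prod hf).integral_prod_left

theorem integral_heatSource_mul_cos {τ t : ℝ}
    (hf : Integrable (fun z : ℝ × EuclideanSpace ℝ (Fin N) => f z.1 z.2)
      ((volume.restrict (Ioo τ t)).prod volume)) (ξ : EuclideanSpace ℝ (Fin N)) (θ : ℝ) :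
    ∫ x, heatSource τ t f x * Real.cos (inner ℝ ξ x + θ) =
      ∫ s in Ioo τ t, Real.exp (-‖ξ‖ ^ 2 * (t - s)) *
        ∫ x, f s x * Real.cos (inner ℝ ξ x + θ) := by
  unfold heatSource
  rw [integral_superposition_mul (integrable_heatSource_prod hf)
    (contDiff_cos_inner_add ξ θ).continuous.aestronglyMeasurable (fun x => Real.abs_cos_le_one _)]
  have hcos : Continuous fun z : ℝ × EuclideanSpace ℝ (Fin N) =>
      Real.exp (-‖ξ‖ ^ 2 * (t - z.1)) * Real.cos (inner ℝ ξ z.2 + θ) := by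
    have := (contDiff_cos_inner_add ξ θ).continuous
    fun_prop
  have hint : Integrable (fun z : ℝ × EuclideanSpace ℝ (Fin N) =>
      f z.1 z.2 * (Real.exp (-‖ξ‖ ^ 2 * (t - z.1)) * Real.cos (inner ℝ ξ z.2 + θ)))
      ((volume.restrict (Ioo τ t)).prod volume) := by
    refine hf.mul_bdd (c := 1) hcos.aestronglyMeasurable ((ae_fst_mem_Ioo τ t).mono fun z hz => ?_)
    rw [norm_mul, Real.norm_eq_abs, Real.abs_exp]
    refine mul_le_one₀ (Real.exp_le_one_iff.2 ?_) (norm_nonneg _) (Real.abs_cos_le_one _)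
    nlinarith [hz.2, sq_nonneg ‖ξ‖, sub_pos.2 hz.2]
  calc _ = ∫ z : ℝ × EuclideanSpace ℝ (Fin N),
      f z.1 z.2 * (Real.exp (-‖ξ‖ ^ 2 * (t - z.1)) * Real.cos (inner ℝ ξ z.2 + θ))
      ∂((volume.restrict (Ioo τ t)).prod volume) := by
        refine integral_congr_ae ((ae_fst_mem_Ioo τ t).mono fun z hz => ?_)
        simp only
        rw [integral_heatKernel_sub_mul_cos (sub_pos.2 hz.2)]
    _ = _ := by
        rw [integral_prod _ hint]
        simp_rw [mul_left_comm (f _ _), integral_const_mul]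

theorem integrable_prod_Ioo
    (hf : Integrable (fun z : ℝ × EuclideanSpace ℝ (Fin N) => f z.1 z.2)
      ((volume.restrict (Ioi (0 : ℝ))).prod volume)) {τ : ℝ} (hτ : 0 ≤ τ) (t : ℝ) :
    Integrable (fun z : ℝ × EuclideanSpace ℝ (Fin N) => f z.1 z.2)
      ((volume.restrict (Ioo τ t)).prod volume) :=
  hf.mono_measure (Measure.prod_mono (Measure.restrict_mono
    (fun _ hs => hτ.trans_lt hs.1) le_rfl) le_rfl)

theorem ae_eq_of_integral_mul_cos_eq {v w : EuclideanSpace ℝ (Fin N) → ℝ} (hv : Integrable v)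
    (hw : Integrable w) (h : ∀ (ξ : EuclideanSpace ℝ (Fin N)) (θ : ℝ),
      ∫ x, v x * Real.cos (inner ℝ ξ x + θ) = ∫ x, w x * Real.cos (inner ℝ ξ x + θ)) :
    v =ᵐ[volume] w := by
  have hcos : ∀ (ξ : EuclideanSpace ℝ (Fin N)) (θ : ℝ) {g : EuclideanSpace ℝ (Fin N) → ℝ},
      Integrable g → Integrable fun x => g x * Real.cos (inner ℝ ξ x + θ) := fun ξ θ g hg =>
    hg.mul_bdd (c := 1) (contDiff_cos_inner_add ξ θ).continuous.aestronglyMeasurable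
      (Eventually.of_forall fun x => Real.abs_cos_le_one _)
  have h0 : v - w =ᵐ[volume] 0 := by
    refine ae_eq_zero_of_integral_mul_cos (hv.sub hw) fun ξ θ => ?_
    simp_rw [Pi.sub_apply, sub_mul]
    rw [integral_sub (hcos ξ θ hv) (hcos ξ θ hw), h, sub_self]
  exact (sub_ae_eq_zero _ _).1 h0

/-- **Duhamel's formula** for weak solutions. -/
theorem IsHeatSolution.ae_eq_heatEvolution_add_heatSource (hu : IsHeatSolution u₀ f u)
    (hu₀ : Integrable u₀ volume)
    (hf : Integrable (fun z : ℝ × EuclideanSpace ℝ (Fin N) => f z.1 z.2)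
      ((volume.restrict (Ioi (0 : ℝ))).prod volume))
    {τ t : ℝ} (hτ : 0 ≤ τ) (hτt : τ < t) :
    u t =ᵐ[volume] fun x => heatEvolution (t - τ) (u τ) x + heatSource τ t f x := by
  have h1 := integrable_heatEvolution (sub_pos.2 hτt) (hu.integrable τ hτ)
  have hf' := integrable_prod_Ioo hf hτ t
  have h2 := integrable_heatSource hf'
  have hcos : ∀ (ξ : EuclideanSpace ℝ (Fin N)) (θ : ℝ) {g : EuclideanSpace ℝ (Fin N) → ℝ},
      Integrable g → Integrable fun x => g x * Real.cos (inner ℝ ξ x + θ) := fun ξ θ g hg =>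
    hg.mul_bdd (c := 1) (contDiff_cos_inner_add ξ θ).continuous.aestronglyMeasurable
      (Eventually.of_forall fun x => Real.abs_cos_le_one _)
  refine ae_eq_of_integral_mul_cos_eq (hu.integrable t (hτ.trans hτt.le)) (h1.add h2)
    fun ξ θ => ?_
  simp_rw [add_mul]
  rw [integral_add (hcos ξ θ h1) (hcos ξ θ h2),
    integral_heatEvolution_mul_cos (sub_pos.2 hτt) (hu.integrable τ hτ),
    integral_heatSource_mul_cos hf', hu.integral_mul_cos_eq_duhamel hu₀ hf ξ θ hτ hτt.le,
    intervalIntegral.integral_of_le hτt.le, integral_Ioc_eq_integral_Ioo]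

/-- The semigroup law, read off from e^{-|ξ|²(s+t)} = e^{-|ξ|²s} e^{-|ξ|²t} on the Fourier side. -/
theorem heatKernel_add_ae_eq_heatEvolution {s t : ℝ} (hs : 0 < s) (ht : 0 < t) :
    heatKernel (s + t) =ᵐ[volume]
      heatEvolution s (heatKernel t : EuclideanSpace ℝ (Fin N) → ℝ) := by
  refine ae_eq_of_integral_mul_cos_eq (integrable_heatKernel (add_pos hs ht))
    (integrable_heatEvolution hs (integrable_heatKernel ht)) fun ξ θ => ?_
  rw [integral_heatEvolution_mul_cos hs (integrable_heatKernel ht),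
    integral_heatKernel_mul_cos ht, integral_heatKernel_mul_cos (add_pos hs ht), mul_add,
    Real.exp_add, mul_assoc]

end Duhamel

/-! ### Dominated convergence for superpositions -/

section DominatedSuperposition

variable {X Z : Type*} [MeasurableSpace X] [MeasurableSpace Z] {μ : Measure X} {ν : Measure Z}

/-- Superpositions of uniformly `L¹`-bounded kernels that tend to zero in `L¹` tend to zero. -/
theorem tendsto_lintegral_enorm_superposition [SFinite μ] [SFinite ν] {k : ℝ → X → Z → ℝ}
    {h : Z → ℝ} (hk : ∀ t, Measurable (Function.uncurry (k t))) (hh : Integrable h ν)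
    {C : ℝ≥0∞} (hC : C ≠ ⊤) (hb : ∀ᶠ t in atTop, ∀ z, ∫⁻ x, ‖k t x z‖ₑ ∂μ ≤ C)
    (hlim : ∀ᵐ z ∂ν, Tendsto (fun t => ∫⁻ x, ‖k t x z‖ₑ ∂μ) atTop (𝓝 0)) :
    Tendsto (fun t => ∫⁻ x, ‖∫ z, k t x z * h z ∂ν‖ₑ ∂μ) atTop (𝓝 0) := by
  -- A measurable representative of h makes the weighted integrand measurable in z.
  obtain ⟨g, hg', hhg⟩ := hh.aestronglyMeasurable
  have hg : Measurable g := hg'.measurable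
  have h1 : Tendsto (fun t => ∫⁻ z, (∫⁻ x, ‖k t x z‖ₑ ∂μ) * ‖g z‖ₑ ∂ν) atTop (𝓝 0) := by
    have h0 : (0 : ℝ≥0∞) = ∫⁻ _z, 0 ∂ν := by simp
    rw [h0]
    refine tendsto_lintegral_filter_of_dominated_convergence (fun z => C * ‖g z‖ₑ) ?_ ?_ ?_ ?_
    · refine Eventually.of_forall fun t => ?_
      exact (Measurable.lintegral_prod_left' (μ := μ) (hk t).enorm).mul hg.enorm
    · filter_upwards [hb] with t ht
      refine Eventually.of_forall fun z => ?_
      gcongr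
      exact ht z
    · rw [lintegral_const_mul' _ _ hC]
      exact (ENNReal.mul_lt_top hC.lt_top (hh.congr hhg).2).ne
    · filter_upwards [hlim] with z hz
      simpa using ENNReal.Tendsto.mul_const hz (Or.inr enorm_ne_top)
  refine tendsto_of_tendsto_of_tendsto_of_le_of_le tendsto_const_nhds h1 (fun _ => zero_le)
    fun t => ?_
  have e : ∫⁻ z, (∫⁻ x, ‖k t x z‖ₑ ∂μ) * ‖g z‖ₑ ∂ν = ∫⁻ z, (∫⁻ x, ‖k t x z‖ₑ ∂μ) * ‖h z‖ₑ ∂ν :=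
    lintegral_congr_ae (hhg.mono fun z hz => by simp only [hz])
  rw [e]
  exact (lintegral_mono fun x => enorm_integral_le_lintegral_enorm _).trans
    (lintegral_lintegral_enorm_mul_le (hk t).aestronglyMeasurable hh.aestronglyMeasurable)

end DominatedSuperposition

/-! ### Limit of the mass and convergence in L¹ -/

section MassAndL1

variable {N : ℕ} {u₀ : EuclideanSpace ℝ (Fin N) → ℝ} {f u : ℝ → EuclideanSpace ℝ (Fin N) → ℝ}

/-- The plane wave with ξ = 0 and θ = 0 is the constant 1, which turns the weak formulation into the
mass balance. -/
theorem IsHeatSolution.tendsto_integral (hu : IsHeatSolution u₀ f u) (hu₀ : Integrable u₀ volume)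
    (hf : Integrable (fun z : ℝ × EuclideanSpace ℝ (Fin N) => f z.1 z.2)
      ((volume.restrict (Ioi (0 : ℝ))).prod volume)) :
    Tendsto (fun t : ℝ => ∫ x, u t x) atTop
      (𝓝 ((∫ x, u₀ x) + ∫ t in Ioi (0 : ℝ), ∫ x, f t x)) := by
  have h1 : IntegrableOn (fun s => ∫ x, f s x) (Ioi 0) := hf.integral_prod_left
  refine ((intervalIntegral_tendsto_integral_Ioi 0 h1 tendsto_id).const_add (∫ x, u₀ x)).congr' ?_
  filter_upwards [eventually_ge_atTop 0] with t ht
  simpa using (hu.integral_mul_cos hu₀ hf 0 0 ht).symm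

theorem tendsto_lintegral_heatEvolution_sub {w : EuclideanSpace ℝ (Fin N) → ℝ}
    (hw : Integrable w) :
    Tendsto (fun t : ℝ => ∫⁻ x, ‖heatEvolution t w x - (∫ y, w y) * heatKernel t x‖ₑ)
      atTop (𝓝 0) := by
  have h := tendsto_lintegral_enorm_superposition (μ := volume)
    (k := fun t (x : EuclideanSpace ℝ (Fin N)) (y : EuclideanSpace ℝ (Fin N)) =>
      heatKernel t (x - y) - heatKernel t x)
    (fun t => (measurable_heatKernel_sub t).sub
      ((continuous_heatKernel t).measurable.comp measurable_fst)) hw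
    (C := 2) (by simp) ?_ ?_
  · refine h.congr' ?_
    filter_upwards [eventually_gt_atTop 0] with t ht
    refine lintegral_congr fun x => ?_
    have hi : Integrable fun y => heatKernel t (x - y) * w y :=
      hw.bdd_mul (c := (4 * Real.pi * t) ^ (-(N : ℝ) / 2))
        ((continuous_heatKernel t).comp (continuous_const.sub continuous_id)).aestronglyMeasurable
        (Eventually.of_forall fun y => by
          rw [Real.norm_of_nonneg (heatKernel_nonneg ht.le _)]
          exact heatKernel_le ht _)
    simp_rw [sub_mul]
    rw [integral_sub hi (hw.const_mul _), integral_const_mul, mul_comm (heatKernel t x)]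
    rfl
  · filter_upwards [eventually_gt_atTop 0] with t ht y
    refine (lintegral_mono fun x => enorm_sub_le).trans ?_
    rw [lintegral_add_right _ (continuous_heatKernel t).measurable.enorm,
      lintegral_enorm_heatKernel_sub ht, lintegral_enorm_heatKernel ht, one_add_one_eq_two]
  · refine Eventually.of_forall fun y => ?_
    simpa using tendsto_lintegral_heatKernel_sub_sub le_rfl y

theorem prod_restrict_Ioo (t : ℝ) :
    (volume.restrict (Ioo 0 t)).prod (volume : Measure (EuclideanSpace ℝ (Fin N))) =
      ((volume.restrict (Ioi 0)).prod volume).restrict (Iio t ×ˢ univ) := by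
  rw [← Measure.prod_restrict, Measure.restrict_univ, Measure.restrict_restrict measurableSet_Iio,
    inter_comm, Ioi_inter_Iio]

/-- The first kernel is cut off to s < t, so everything is integrated against f on the fixed
half-line: the difference kernel keeps L¹ norm at most 2, and each fixed s is eventually below t.
The tail mass of f thus needs no separate estimate. -/
theorem tendsto_lintegral_heatSource_sub
    (hf : Integrable (fun z : ℝ × EuclideanSpace ℝ (Fin N) => f z.1 z.2)
      ((volume.restrict (Ioi (0 : ℝ))).prod volume)) :
    Tendsto (fun t : ℝ => ∫⁻ x,
      ‖heatSource 0 t f x - (∫ t in Ioi (0 : ℝ), ∫ x, f t x) * heatKernel t x‖ₑ)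
      atTop (𝓝 0) := by
  have hms : ∀ t : ℝ, MeasurableSet (Iio t ×ˢ (univ : Set (EuclideanSpace ℝ (Fin N)))) :=
    fun t => measurableSet_Iio.prod MeasurableSet.univ
  have h := tendsto_lintegral_enorm_superposition (μ := volume)
    (k := fun t (x : EuclideanSpace ℝ (Fin N)) (z : ℝ × EuclideanSpace ℝ (Fin N)) =>
      (Iio t ×ˢ univ).indicator (fun z => heatKernel (t - z.1) (x - z.2)) z - heatKernel t x)
    (fun t => ?_) hf (C := 2) (by simp) ?_ ?_
  · refine h.congr' ?_
    filter_upwards [eventually_gt_atTop 0] with t ht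
    have hf' := integrable_prod_Ioo hf le_rfl t
    refine lintegral_congr_ae ?_
    filter_upwards [(integrable_heatSource_prod hf').prod_right_ae] with x hx
    simp only [Function.uncurry_apply_pair] at hx
    rw [prod_restrict_Ioo] at hx
    have e : ∀ z : ℝ × EuclideanSpace ℝ (Fin N),
        ((Iio t ×ˢ univ).indicator (fun z => heatKernel (t - z.1) (x - z.2)) z -
          heatKernel t x) * f z.1 z.2 =
        (Iio t ×ˢ univ).indicator (fun z => heatKernel (t - z.1) (x - z.2) * f z.1 z.2) z -
          heatKernel t x * f z.1 z.2 := fun z => by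
      rw [sub_mul, indicator_mul_left]
    simp_rw [e]
    rw [integral_sub ((integrable_indicator_iff (hms t)).2 hx) (hf.const_mul _),
      integral_indicator (hms t), ← prod_restrict_Ioo, integral_const_mul, integral_prod _ hf,
      mul_comm (heatKernel t x)]
    rfl
  · refine Measurable.sub ?_ ((continuous_heatKernel t).measurable.comp measurable_fst)
    exact (measurable_heatKernel_sub_sub t).indicator (measurable_snd (hms t))
  · filter_upwards [eventually_gt_atTop 0] with t ht z
    refine (lintegral_mono fun x => enorm_sub_le).trans ?_
    rw [lintegral_add_right _ (continuous_heatKernel t).measurable.enorm,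
      lintegral_enorm_heatKernel ht]
    refine (add_le_add ?_ le_rfl).trans one_add_one_eq_two.le
    by_cases hz : z ∈ Iio t ×ˢ (univ : Set (EuclideanSpace ℝ (Fin N)))
    · simp only [indicator_of_mem hz]
      exact (lintegral_enorm_heatKernel_sub (sub_pos.2 hz.1) z.2).le
    · simp [indicator_of_notMem hz]
  · filter_upwards [Measure.quasiMeasurePreserving_fst.ae (ae_restrict_mem measurableSet_Ioi)]
      with z hz
    refine (tendsto_lintegral_heatKernel_sub_sub (le_of_lt hz) z.2).congr' ?_
    filter_upwards [eventually_gt_atTop z.1] with t ht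
    have hz' : z ∈ Iio t ×ˢ (univ : Set (EuclideanSpace ℝ (Fin N))) := ⟨ht, mem_univ _⟩
    simp only [indicator_of_mem hz']

/-- Convergence in `L¹` to the multiple of the heat kernel with the limiting mass. -/
theorem IsHeatSolution.tendsto_eLpNorm_one (hu : IsHeatSolution u₀ f u)
    (hu₀ : Integrable u₀ volume)
    (hf : Integrable (fun z : ℝ × EuclideanSpace ℝ (Fin N) => f z.1 z.2)
      ((volume.restrict (Ioi (0 : ℝ))).prod volume)) :
    Tendsto (fun t : ℝ => eLpNorm (fun x => u t x -
      ((∫ x, u₀ x) + ∫ t in Ioi (0 : ℝ), ∫ x, f t x) * heatKernel t x) 1 volume)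
      atTop (𝓝 0) := by
  have h := (tendsto_lintegral_heatEvolution_sub hu₀).add (tendsto_lintegral_heatSource_sub hf)
  rw [add_zero] at h
  refine tendsto_of_tendsto_of_tendsto_of_le_of_le' tendsto_const_nhds h
    (Eventually.of_forall fun _ => zero_le) ?_
  filter_upwards [eventually_gt_atTop 0] with t ht
  rw [eLpNorm_one_eq_lintegral_enorm, ← lintegral_add_left']
  · refine lintegral_mono_ae ?_
    filter_upwards [hu.ae_eq_heatEvolution_add_heatSource hu₀ hf le_rfl ht] with x hx
    have e : heatEvolution (t - 0) (u 0) x = heatEvolution t u₀ x := by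
      rw [sub_zero]
      exact integral_congr_ae (hu.initial.mono fun y hy => by simp only [hy])
    rw [hx, e, add_mul, add_sub_add_comm]
    exact enorm_add_le _ _
  · exact ((integrable_heatEvolution ht hu₀).sub
      ((integrable_heatKernel ht).const_mul _)).aestronglyMeasurable.enorm

end MassAndL1

/-! ### Calculus of weak gradients -/

section WeakGradient

variable {N : ℕ}

theorem continuous_gradient_of_contDiff {v : EuclideanSpace ℝ (Fin N) → ℝ}
    (hv : ContDiff ℝ ∞ v) : Continuous (gradient v) :=
  (InnerProductSpace.toDual ℝ _).symm.continuous.comp (hv.continuous_fderiv (by simp))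

theorem HasCompactSupport.gradient {v : EuclideanSpace ℝ (Fin N) → ℝ}
    (hv : HasCompactSupport v) : HasCompactSupport (gradient v) :=
  (hv.fderiv (𝕜 := ℝ)).comp_left (map_zero _)

theorem isWeakGradient_gradient {v : EuclideanSpace ℝ (Fin N) → ℝ} (hv : ContDiff ℝ ∞ v) :
    IsWeakGradient v (gradient v) where
  locallyIntegrable := hv.continuous.locallyIntegrable
  locallyIntegrable_gradient := (continuous_gradient_of_contDiff hv).locallyIntegrable
  integral_eq φ hφ hφs := by
    have hvc := hv.continuous
    have hφc := hφ.continuous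
    have hvg := continuous_gradient_of_contDiff hv
    have hφg := continuous_gradient_of_contDiff hφ
    have h1 : Integrable fun x => v x • gradient φ x :=
      (hvc.smul hφg).integrable_of_hasCompactSupport (hφs.gradient.smul_left (f := v))
    have h2 : Integrable fun x => φ x • gradient v x :=
      (hφc.smul hvg).integrable_of_hasCompactSupport (hφs.smul_right (f' := gradient v))
    have h3 : Integrable fun x => v x * φ x :=
      (hvc.mul hφc).integrable_of_hasCompactSupport (hφs.mul_left (f := v))
    -- Pairing with a fixed vector e reduces the vector identity to integration by parts for the
    -- derivative in direction e.
    refine ext_inner_left ℝ fun e => ?_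
    rw [inner_neg_right, ← integral_inner h1, ← integral_inner h2]
    have e1 : ∀ x, inner ℝ e (v x • gradient φ x) = v x * fderiv ℝ φ x e := fun x => by
      rw [inner_smul_right, real_inner_comm, inner_gradient_left]
    have e2 : ∀ x, inner ℝ e (φ x • gradient v x) = fderiv ℝ v x e * φ x := fun x => by
      rw [inner_smul_right, real_inner_comm, inner_gradient_left, mul_comm]
    have i1 := h1.const_inner (𝕜 := ℝ) e
    have i2 := h2.const_inner (𝕜 := ℝ) e
    simp_rw [e1] at i1 ⊢
    simp_rw [e2] at i2 ⊢
    exact integral_mul_fderiv_eq_neg_fderiv_mul_of_integrable i2 i1 h3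
      (fun x _ => (hv.differentiable (by simp)).differentiableAt)
      (fun x _ => (hφ.differentiable (by simp)).differentiableAt)

theorem IsWeakGradient.congr_ae {v v' : EuclideanSpace ℝ (Fin N) → ℝ}
    {g : EuclideanSpace ℝ (Fin N) → EuclideanSpace ℝ (Fin N)} (h : IsWeakGradient v g)
    (hv : v =ᵐ[volume] v') : IsWeakGradient v' g where
  locallyIntegrable := h.locallyIntegrable.congr hv
  locallyIntegrable_gradient := h.locallyIntegrable_gradient
  integral_eq φ hφ hφs := by
    rw [← h.integral_eq φ hφ hφs]
    exact integral_congr_ae (hv.mono fun x hx => by simp only [hx])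

theorem IsWeakGradient.add {v v' : EuclideanSpace ℝ (Fin N) → ℝ}
    {g g' : EuclideanSpace ℝ (Fin N) → EuclideanSpace ℝ (Fin N)} (h : IsWeakGradient v g)
    (h' : IsWeakGradient v' g') :
    IsWeakGradient (fun x => v x + v' x) (fun x => g x + g' x) where
  locallyIntegrable := h.locallyIntegrable.add h'.locallyIntegrable
  locallyIntegrable_gradient := h.locallyIntegrable_gradient.add h'.locallyIntegrable_gradient
  integral_eq φ hφ hφs := by
    have hφg := continuous_gradient_of_contDiff hφ
    simp_rw [add_smul, smul_add]
    rw [integral_add, integral_add, neg_add, h.integral_eq φ hφ hφs, h'.integral_eq φ hφ hφs]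
    · exact h.locallyIntegrable_gradient.integrable_smul_left_of_hasCompactSupport hφ.continuous hφs
    · exact h'.locallyIntegrable_gradient.integrable_smul_left_of_hasCompactSupport hφ.continuous
        hφs
    · exact h.locallyIntegrable.integrable_smul_right_of_hasCompactSupport hφg hφs.gradient
    · exact h'.locallyIntegrable.integrable_smul_right_of_hasCompactSupport hφg hφs.gradient

theorem IsWeakGradient.const_mul {v : EuclideanSpace ℝ (Fin N) → ℝ}
    {g : EuclideanSpace ℝ (Fin N) → EuclideanSpace ℝ (Fin N)} (h : IsWeakGradient v g) (c : ℝ) :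
    IsWeakGradient (fun x => c * v x) (fun x => c • g x) where
  locallyIntegrable := h.locallyIntegrable.smul c
  locallyIntegrable_gradient := h.locallyIntegrable_gradient.smul c
  integral_eq φ hφ hφs := by
    simp_rw [mul_smul, smul_comm _ c]
    rw [integral_smul, integral_smul, h.integral_eq φ hφ hφs, smul_neg]

variable {Z : Type*} [MeasurableSpace Z] {ν : Measure Z} [SFinite ν]

theorem integrable_restrict_prod {F : Type*} [NormedAddCommGroup F]
    {k : EuclideanSpace ℝ (Fin N) → Z → F}
    (hk : AEStronglyMeasurable (Function.uncurry k) (volume.prod ν))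
    {K : Set (EuclideanSpace ℝ (Fin N))}
    (hfin : ∫⁻ x in K, ∫⁻ z, ‖k x z‖ₑ ∂ν ≠ ⊤) :
    Integrable (Function.uncurry k) ((volume.restrict K).prod ν) := by
  have hm : AEStronglyMeasurable (Function.uncurry k) ((volume.restrict K).prod ν) :=
    hk.mono_measure (Measure.prod_mono Measure.restrict_le_self le_rfl)
  refine ⟨hm, ?_⟩
  rw [hasFiniteIntegral_iff_enorm, lintegral_prod _ hm.enorm]
  exact hfin.lt_top

theorem locallyIntegrable_integral {F : Type*} [NormedAddCommGroup F] [NormedSpace ℝ F]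
    {k : EuclideanSpace ℝ (Fin N) → Z → F}
    (hk : AEStronglyMeasurable (Function.uncurry k) (volume.prod ν))
    (hfin : ∀ K : Set (EuclideanSpace ℝ (Fin N)), IsCompact K →
      ∫⁻ x in K, ∫⁻ z, ‖k x z‖ₑ ∂ν ≠ ⊤) :
    LocallyIntegrable (fun x => ∫ z, k x z ∂ν) volume :=
  locallyIntegrable_iff.2 fun K hK => (integrable_restrict_prod hk (hfin K hK)).integral_prod_left

theorem integrable_prod_of_compactSupport {F G : Type*} [NormedAddCommGroup F]
    [NormedAddCommGroup G] {k : EuclideanSpace ℝ (Fin N) → Z → F}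
    {m : EuclideanSpace ℝ (Fin N) → Z → G}
    (hm : AEStronglyMeasurable (Function.uncurry m) (volume.prod ν))
    {K : Set (EuclideanSpace ℝ (Fin N))} (hK : IsCompact K)
    (hfin : ∫⁻ x in K, ∫⁻ z, ‖k x z‖ₑ ∂ν ≠ ⊤) {M : ℝ≥0∞} (hM : M ≠ ⊤)
    (hmk : ∀ x z, ‖m x z‖ₑ ≤ M * ‖k x z‖ₑ) (hmK : ∀ x ∉ K, ∀ z, m x z = 0) :
    Integrable (Function.uncurry m) (volume.prod ν) := by
  refine ⟨hm, ?_⟩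
  rw [hasFiniteIntegral_iff_enorm, lintegral_prod _ hm.enorm]
  have h1 : ∀ x, ∫⁻ z, ‖m x z‖ₑ ∂ν ≤ K.indicator (fun x => M * ∫⁻ z, ‖k x z‖ₑ ∂ν) x := by
    intro x
    by_cases hx : x ∈ K
    · rw [indicator_of_mem hx, ← lintegral_const_mul' _ _ hM]
      exact lintegral_mono fun z => hmk x z
    · simp [hmK x hx, indicator_of_notMem hx]
  refine (lintegral_mono h1).trans_lt ?_
  rw [lintegral_indicator hK.measurableSet, lintegral_const_mul' _ _ hM]
  exact ENNReal.mul_lt_top hM.lt_top hfin.lt_top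

/-- Superpositions of weak gradients are weak gradients. -/
theorem IsWeakGradient.integral {k : EuclideanSpace ℝ (Fin N) → Z → ℝ}
    {d : EuclideanSpace ℝ (Fin N) → Z → EuclideanSpace ℝ (Fin N)}
    (hk : AEStronglyMeasurable (Function.uncurry k) (volume.prod ν))
    (hd : AEStronglyMeasurable (Function.uncurry d) (volume.prod ν))
    (hkfin : ∀ K : Set (EuclideanSpace ℝ (Fin N)), IsCompact K →
      ∫⁻ x in K, ∫⁻ z, ‖k x z‖ₑ ∂ν ≠ ⊤)
    (hdfin : ∀ K : Set (EuclideanSpace ℝ (Fin N)), IsCompact K →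
      ∫⁻ x in K, ∫⁻ z, ‖d x z‖ₑ ∂ν ≠ ⊤)
    (h : ∀ᵐ z ∂ν, IsWeakGradient (fun x => k x z) (fun x => d x z)) :
    IsWeakGradient (fun x => ∫ z, k x z ∂ν) (fun x => ∫ z, d x z ∂ν) where
  locallyIntegrable := locallyIntegrable_integral hk hkfin
  locallyIntegrable_gradient := locallyIntegrable_integral hd hdfin
  integral_eq φ hφ hφs := by
    have hφg := continuous_gradient_of_contDiff hφ
    obtain ⟨A, hA⟩ := hφs.exists_bound_of_continuous hφ.continuous
    obtain ⟨B, hB⟩ := hφs.gradient.exists_bound_of_continuous hφg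
    have i1 : Integrable (Function.uncurry fun x z => k x z • gradient φ x) (volume.prod ν) := by
      refine integrable_prod_of_compactSupport
        (hk.smul hφg.aestronglyMeasurable.comp_fst) hφs.gradient (hkfin _ hφs.gradient)
        (M := ENNReal.ofReal B) ENNReal.ofReal_ne_top (fun x z => ?_) fun x hx z => ?_
      · rw [enorm_smul, mul_comm]
        gcongr
        rw [← ofReal_norm]
        exact ENNReal.ofReal_le_ofReal (hB x)
      · rw [image_eq_zero_of_notMem_tsupport hx, smul_zero]
    have i2 : Integrable (Function.uncurry fun x z => φ x • d x z) (volume.prod ν) := by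
      refine integrable_prod_of_compactSupport
        (hφ.continuous.aestronglyMeasurable.comp_fst.smul hd) hφs (hdfin _ hφs)
        (M := ENNReal.ofReal A) ENNReal.ofReal_ne_top (fun x z => ?_) fun x hx z => ?_
      · rw [enorm_smul]
        gcongr
        rw [← ofReal_norm]
        exact ENNReal.ofReal_le_ofReal (hA x)
      · rw [image_eq_zero_of_notMem_tsupport hx, zero_smul]
    -- Fubini on both sides reduces the claim to the identity for almost every z; the compact
    -- support of φ makes local bounds sufficient.
    simp_rw [← integral_smul_const, ← integral_smul]
    rw [integral_integral_swap i1, integral_integral_swap i2, ← integral_neg]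
    exact integral_congr_ae (h.mono fun z hz => hz.integral_eq φ hφ hφs)

/-- A function with finite `L^p` norm has finite integral over compact sets. -/
theorem setLIntegral_ne_top_of_eLpNorm_ne_top {H : EuclideanSpace ℝ (Fin N) → ℝ≥0∞}
    (hH : AEMeasurable H) {p : ℝ≥0∞} (hp : 1 ≤ p) (hfin : eLpNorm H p volume ≠ ⊤)
    {K : Set (EuclideanSpace ℝ (Fin N))} (hK : IsCompact K) : ∫⁻ x in K, H x ≠ ⊤ := by
  have h := eLpNorm_le_eLpNorm_mul_rpow_measure_univ hp
    (hH.aestronglyMeasurable.mono_measure (Measure.restrict_le_self (s := K)))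
  rw [eLpNorm_one_eq_lintegral_enorm] at h
  simp only [enorm_eq_self] at h
  refine (h.trans_lt (ENNReal.mul_lt_top ?_ ?_)).ne
  · exact (eLpNorm_mono_measure _ Measure.restrict_le_self).trans_lt hfin.lt_top
  · rw [Measure.restrict_apply_univ]
    refine ENNReal.rpow_lt_top_of_nonneg ?_ hK.measure_lt_top.ne
    rcases eq_or_ne p ⊤ with rfl | hpt
    · simp
    · have : 1 ≤ p.toReal := by
        rw [← ENNReal.toReal_one]
        exact (ENNReal.toReal_le_toReal ENNReal.one_ne_top hpt).2 hp
      rw [ENNReal.toReal_one, div_one, sub_nonneg, one_div]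
      exact inv_le_one_of_one_le₀ this

end WeakGradient

/-! ### Young-type convolution inequalities -/

section Young

variable {N : ℕ} {F : Type*} [NormedAddCommGroup F]

theorem eLpNorm_comp_sub_right {K : EuclideanSpace ℝ (Fin N) → F}
    (hK : AEStronglyMeasurable K volume) (p : ℝ≥0∞) (y : EuclideanSpace ℝ (Fin N)) :
    eLpNorm (fun x => K (x - y)) p volume = eLpNorm K p volume :=
  eLpNorm_comp_measurePreserving hK (measurePreserving_sub_right volume y)

variable [NormedSpace ℝ F]

theorem aestronglyMeasurable_smul_comp_sub {K : EuclideanSpace ℝ (Fin N) → F}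
    (hK : Continuous K) {w : EuclideanSpace ℝ (Fin N) → ℝ} (hw : AEStronglyMeasurable w volume) :
    AEStronglyMeasurable (Function.uncurry fun x y => w y • K (x - y))
      ((volume : Measure (EuclideanSpace ℝ (Fin N))).prod volume) :=
  hw.comp_snd.smul (hK.comp (continuous_fst.sub continuous_snd)).aestronglyMeasurable

/-- Young's inequality `‖K * w‖_p ≤ ‖K‖_p ‖w‖₁`. -/
theorem eLpNorm_lintegral_smul_comp_sub_le {K : EuclideanSpace ℝ (Fin N) → F}
    (hK : Continuous K) {w : EuclideanSpace ℝ (Fin N) → ℝ} (hw : AEStronglyMeasurable w volume)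
    {p : ℝ≥0∞} (hp : 1 ≤ p) :
    eLpNorm (fun x => ∫⁻ y, ‖w y • K (x - y)‖ₑ) p volume ≤
      eLpNorm K p volume * ∫⁻ y, ‖w y‖ₑ := by
  -- Minkowski with parameter y: the translates of K share one L^p norm. Keeping absolute values
  -- inside the integral also yields the absolute convergence needed for weak gradients.
  refine (eLpNorm_lintegral_le (F := fun x y => ‖w y • K (x - y)‖ₑ)
    (aestronglyMeasurable_smul_comp_sub hK hw).enorm
    (M := fun y => ‖w y‖ₑ * eLpNorm K p volume) (hw.enorm.mul_const _) hp
    (Eventually.of_forall fun y => ?_)).trans ?_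
  · rw [eLpNorm_enorm, ← eLpNorm_comp_sub_right hK.aestronglyMeasurable p y]
    exact (eLpNorm_const_smul (w y) (fun x => K (x - y)) p volume).le
  · rw [lintegral_mul_const'' _ hw.enorm, mul_comm]

variable [MeasurableSpace F] [BorelSpace F]

theorem aestronglyMeasurable_smul_comp_sub_sub [SecondCountableTopology F]
    {K : ℝ → EuclideanSpace ℝ (Fin N) → F}
    (hK : Measurable fun q : ℝ × EuclideanSpace ℝ (Fin N) => K q.1 q.2)
    {f : ℝ → EuclideanSpace ℝ (Fin N) → ℝ} {τ t : ℝ}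
    (hf : AEStronglyMeasurable (fun z : ℝ × EuclideanSpace ℝ (Fin N) => f z.1 z.2)
      ((volume.restrict (Ioo τ t)).prod volume)) :
    AEStronglyMeasurable (Function.uncurry fun (x : EuclideanSpace ℝ (Fin N))
      (z : ℝ × EuclideanSpace ℝ (Fin N)) => f z.1 z.2 • K (t - z.1) (x - z.2))
      (volume.prod ((volume.restrict (Ioo τ t)).prod volume)) := by
  refine hf.comp_snd.smul (Measurable.aestronglyMeasurable ?_)
  exact hK.comp ((measurable_const.sub (measurable_fst.comp measurable_snd)).prodMk
      (measurable_fst.sub (measurable_snd.comp measurable_snd)))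

/-- Young's inequality `‖∫ K(t-s) * f(s) ds‖_p ≤ (sup ‖f(s)‖_p) ∫ ‖K(t-s)‖₁ ds`. -/
theorem eLpNorm_lintegral_smul_comp_sub_sub_le {K : ℝ → EuclideanSpace ℝ (Fin N) → F}
    (hK : Measurable fun q : ℝ × EuclideanSpace ℝ (Fin N) => K q.1 q.2)
    {f : ℝ → EuclideanSpace ℝ (Fin N) → ℝ} {τ t : ℝ}
    (hf : AEStronglyMeasurable (fun z : ℝ × EuclideanSpace ℝ (Fin N) => f z.1 z.2)
      ((volume.restrict (Ioo τ t)).prod volume)) {p : ℝ≥0∞} (hp : 1 ≤ p) {B : ℝ≥0∞}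
    (hB : ∀ s ∈ Ioo τ t, eLpNorm (f s) p volume ≤ B) :
    eLpNorm (fun x => ∫⁻ z : ℝ × EuclideanSpace ℝ (Fin N),
      ‖f z.1 z.2 • K (t - z.1) (x - z.2)‖ₑ ∂((volume.restrict (Ioo τ t)).prod volume)) p volume ≤
      B * ∫⁻ s in Ioo τ t, ∫⁻ y, ‖K (t - s) y‖ₑ := by
  obtain ⟨g, hgs, hfg⟩ := hf
  have hg : Measurable g := hgs.measurable
  have hKt : Measurable fun q : ℝ × EuclideanSpace ℝ (Fin N) => K (t - q.1) q.2 :=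
    hK.comp ((measurable_const.sub measurable_fst).prodMk measurable_snd)
  -- The change y ↦ x - y moves the translation from the kernel to the source. Minkowski then places
  -- the L^p norm on f(s) and leaves only the L¹ norm of K(t-s).
  have hswap : ∀ x : EuclideanSpace ℝ (Fin N), ∫⁻ z : ℝ × EuclideanSpace ℝ (Fin N),
      ‖f z.1 z.2 • K (t - z.1) (x - z.2)‖ₑ ∂((volume.restrict (Ioo τ t)).prod volume) =
      ∫⁻ z : ℝ × EuclideanSpace ℝ (Fin N), ‖‖K (t - z.1) z.2‖ • g (z.1, x - z.2)‖ₑ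
        ∂((volume.restrict (Ioo τ t)).prod volume) := by
    intro x
    have e1 : ∫⁻ z : ℝ × EuclideanSpace ℝ (Fin N),
        ‖f z.1 z.2 • K (t - z.1) (x - z.2)‖ₑ ∂((volume.restrict (Ioo τ t)).prod volume) =
        ∫⁻ z : ℝ × EuclideanSpace ℝ (Fin N), ‖g z‖ₑ * ‖K (t - z.1) (x - z.2)‖ₑ
          ∂((volume.restrict (Ioo τ t)).prod volume) :=
      lintegral_congr_ae (hfg.mono fun z hz => by simp only [enorm_smul, hz])
    have hx : Measurable fun z : ℝ × EuclideanSpace ℝ (Fin N) => (z.1, x - z.2) :=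
      measurable_fst.prodMk (measurable_const.sub measurable_snd)
    have hm1 : Measurable fun z : ℝ × EuclideanSpace ℝ (Fin N) =>
        ‖g z‖ₑ * ‖K (t - z.1) (x - z.2)‖ₑ := hg.enorm.mul (hKt.comp hx).enorm
    have hm2 : Measurable fun z : ℝ × EuclideanSpace ℝ (Fin N) =>
        ‖‖K (t - z.1) z.2‖ • g (z.1, x - z.2)‖ₑ := (hKt.norm.smul (hg.comp hx)).enorm
    rw [e1, lintegral_prod _ hm1.aemeasurable, lintegral_prod _ hm2.aemeasurable]
    refine lintegral_congr fun s => ?_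
    rw [← lintegral_sub_left_eq_self _ x]
    refine lintegral_congr fun y => ?_
    simp only [sub_sub_cancel, enorm_smul, enorm_norm]
    rw [mul_comm]
  simp_rw [hswap]
  have hBz : ∀ᵐ z : ℝ × EuclideanSpace ℝ (Fin N) ∂((volume.restrict (Ioo τ t)).prod volume),
      eLpNorm (fun x => g (z.1, x)) p volume ≤ B := by
    refine Measure.quasiMeasurePreserving_fst.ae (p := fun s =>
      eLpNorm (fun x => g (s, x)) p volume ≤ B) ?_
    filter_upwards [Measure.ae_ae_of_ae_prod hfg, ae_restrict_mem measurableSet_Ioo] with s hs hsI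
    exact (eLpNorm_congr_ae hs).symm.trans_le (hB s hsI)
  refine (eLpNorm_lintegral_le (M := fun z => B * ‖K (t - z.1) z.2‖ₑ) ?_
    (hKt.enorm.const_mul B).aemeasurable hp ?_).trans ?_
  · refine Measurable.aemeasurable (Measurable.enorm ?_)
    exact (hKt.comp measurable_snd).norm.smul (hg.comp ((measurable_fst.comp measurable_snd).prodMk
      (measurable_fst.sub (measurable_snd.comp measurable_snd))))
  · filter_upwards [hBz] with z hz
    rw [eLpNorm_enorm]
    have h1 := eLpNorm_comp_sub_right (K := fun x => g (z.1, x))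
      (hg.comp measurable_prodMk_left).aestronglyMeasurable p z.2
    have h2 := eLpNorm_const_smul ‖K (t - z.1) z.2‖ (fun x => g (z.1, x - z.2)) p volume
    refine h2.le.trans ?_
    rw [h1, enorm_norm, mul_comm]
    gcongr
  · rw [lintegral_const_mul _ hKt.enorm, lintegral_prod _ hKt.enorm.aemeasurable]

end Young

/-! ### Bounds and weak gradients for the two Duhamel terms -/

section HeatGradient

variable {N : ℕ} {f : ℝ → EuclideanSpace ℝ (Fin N) → ℝ} {τ t : ℝ}

/-- The gradient of `heatEvolution t w`. -/
noncomputable def heatEvolutionGradient (t : ℝ) (w : EuclideanSpace ℝ (Fin N) → ℝ)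
    (x : EuclideanSpace ℝ (Fin N)) : EuclideanSpace ℝ (Fin N) :=
  ∫ y, w y • gradient (heatKernel t) (x - y)

/-- The gradient of `heatSource τ t f`. -/
noncomputable def heatSourceGradient (τ t : ℝ) (f : ℝ → EuclideanSpace ℝ (Fin N) → ℝ)
    (x : EuclideanSpace ℝ (Fin N)) : EuclideanSpace ℝ (Fin N) :=
  ∫ z : ℝ × EuclideanSpace ℝ (Fin N), f z.1 z.2 • gradient (heatKernel (t - z.1)) (x - z.2)
    ∂((volume.restrict (Ioo τ t)).prod volume)

theorem isWeakGradient_heatKernel_sub (t c : ℝ) (y : EuclideanSpace ℝ (Fin N)) :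
    IsWeakGradient (fun x => c * heatKernel t (x - y))
      (fun x => c • gradient (heatKernel t) (x - y)) := by
  have h : ContDiff ℝ ∞ fun x : EuclideanSpace ℝ (Fin N) => heatKernel t (x - y) :=
    (contDiff_heatKernel t).comp (contDiff_id.sub contDiff_const)
  have h2 := (isWeakGradient_gradient h).const_mul c
  have e : gradient (fun x : EuclideanSpace ℝ (Fin N) => heatKernel t (x - y)) =
      fun x => gradient (heatKernel t) (x - y) := by
    funext x
    simp only [gradient]
    simp_rw [sub_eq_add_neg]
    rw [fderiv_comp_add_right]
  rwa [e] at h2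

theorem lintegral_enorm_gradient_heatKernel_le (ht : 0 < t) :
    ∫⁻ x : EuclideanSpace ℝ (Fin N), ‖gradient (heatKernel t) x‖ₑ ≤
      ENNReal.ofReal (2 * 2 ^ ((N : ℝ) / 2) * t ^ (-(1 / 2) : ℝ)) := by
  have := eLpNorm_gradient_heatKernel_le (N := N) ht le_rfl
  rw [eLpNorm_one_eq_lintegral_enorm] at this
  simpa using this

theorem lintegral_Ioo_heatKernel (τ t : ℝ) :
    ∫⁻ s in Ioo τ t, ∫⁻ y : EuclideanSpace ℝ (Fin N), ‖heatKernel (t - s) y‖ₑ =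
      ENNReal.ofReal (t - τ) := by
  rw [setLIntegral_congr_fun measurableSet_Ioo (g := fun _ => 1)
    fun s hs => lintegral_enorm_heatKernel (sub_pos.2 hs.2)]
  simp

/-- The bound ‖∇G(t-s)‖₁ ≤ C(t-s)^{-1/2} is integrable up to s = t, with ∫ (t-s)^{-1/2} ds =
2(t-τ)^{1/2}. -/
theorem lintegral_Ioo_gradient_heatKernel_le (hτt : τ ≤ t) :
    ∫⁻ s in Ioo τ t, ∫⁻ y : EuclideanSpace ℝ (Fin N), ‖gradient (heatKernel (t - s)) y‖ₑ ≤
      ENNReal.ofReal (2 * (2 * 2 ^ ((N : ℝ) / 2)) * (t - τ) ^ (1 / 2 : ℝ)) := by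
  have hint : IntervalIntegrable (fun s => (t - s) ^ (-(1 / 2) : ℝ)) volume τ t := by
    have h := (intervalIntegral.intervalIntegrable_rpow' (a := t - τ) (b := 0)
      (r := (-(1 / 2) : ℝ)) (by norm_num)).comp_sub_left t
    simpa using h
  have hval : ∫ s in τ..t, (t - s) ^ (-(1 / 2) : ℝ) = 2 * (t - τ) ^ (1 / 2 : ℝ) := by
    rw [intervalIntegral.integral_comp_sub_left (fun s => s ^ (-(1 / 2) : ℝ)) t, sub_self,
      integral_rpow (Or.inl (by norm_num))]
    norm_num
    ring
  rw [intervalIntegrable_iff, uIoc_of_le hτt] at hint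
  replace hint := hint.mono_set Ioo_subset_Ioc_self
  rw [intervalIntegral.integral_of_le hτt, integral_Ioc_eq_integral_Ioo] at hval
  calc ∫⁻ s in Ioo τ t, ∫⁻ y : EuclideanSpace ℝ (Fin N), ‖gradient (heatKernel (t - s)) y‖ₑ
      ≤ ∫⁻ s in Ioo τ t,
        ENNReal.ofReal (2 * 2 ^ ((N : ℝ) / 2) * (t - s) ^ (-(1 / 2) : ℝ)) :=
        setLIntegral_mono' measurableSet_Ioo fun s hs =>
          lintegral_enorm_gradient_heatKernel_le (sub_pos.2 hs.2)
    _ = ENNReal.ofReal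
        (∫ s in Ioo τ t, 2 * 2 ^ ((N : ℝ) / 2) * (t - s) ^ (-(1 / 2) : ℝ)) := by
        rw [ofReal_integral_eq_lintegral_ofReal (hint.const_mul _)]
        filter_upwards [ae_restrict_mem measurableSet_Ioo] with s hs
        have := sub_pos.2 hs.2
        positivity
    _ = _ := by
        rw [integral_const_mul, hval]
        congr 1; ring

theorem heatEvolution_eq_integral_smul (t : ℝ) (w : EuclideanSpace ℝ (Fin N) → ℝ) :
    heatEvolution t w = fun x => ∫ y, w y • heatKernel t (x - y) := by
  funext x
  simp_rw [smul_eq_mul, mul_comm (w _)]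
  rfl

theorem heatSource_eq_integral_smul (τ t : ℝ) (f : ℝ → EuclideanSpace ℝ (Fin N) → ℝ) :
    heatSource τ t f = fun x => ∫ z : ℝ × EuclideanSpace ℝ (Fin N),
      f z.1 z.2 • heatKernel (t - z.1) (x - z.2) ∂((volume.restrict (Ioo τ t)).prod volume) := by
  funext x
  simp_rw [smul_eq_mul, mul_comm (f _ _)]
  rfl

theorem eLpNorm_integral_le_eLpNorm_lintegral {X Z F : Type*} [MeasurableSpace X]
    [MeasurableSpace Z] [NormedAddCommGroup F] [NormedSpace ℝ F] {μ : Measure X} {ν : Measure Z}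
    (k : X → Z → F) (p : ℝ≥0∞) :
    eLpNorm (fun x => ∫ z, k x z ∂ν) p μ ≤ eLpNorm (fun x => ∫⁻ z, ‖k x z‖ₑ ∂ν) p μ :=
  eLpNorm_mono_enorm fun x => by
    rw [enorm_eq_self]; exact enorm_integral_le_lintegral_enorm _

theorem eLpNorm_heatEvolution_le (ht : 0 < t) {w : EuclideanSpace ℝ (Fin N) → ℝ}
    (hw : Integrable w) {p : ℝ≥0∞} (hp : 1 ≤ p) :
    eLpNorm (heatEvolution t w) p volume ≤
      ENNReal.ofReal (t ^ (-((N : ℝ) / 2 * (1 - (p⁻¹).toReal)))) * eLpNorm w 1 volume := by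
  rw [heatEvolution_eq_integral_smul, eLpNorm_one_eq_lintegral_enorm]
  refine (eLpNorm_integral_le_eLpNorm_lintegral _ p).trans
    ((eLpNorm_lintegral_smul_comp_sub_le (continuous_heatKernel t) hw.1 hp).trans ?_)
  gcongr
  exact eLpNorm_heatKernel_le ht hp

theorem eLpNorm_heatEvolutionGradient_le (ht : 0 < t) {w : EuclideanSpace ℝ (Fin N) → ℝ}
    (hw : Integrable w) {p : ℝ≥0∞} (hp : 1 ≤ p) :
    eLpNorm (heatEvolutionGradient t w) p volume ≤
      ENNReal.ofReal (2 * 2 ^ ((N : ℝ) / 2) *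
        t ^ (-((N : ℝ) / 2 * (1 - (p⁻¹).toReal) + 1 / 2))) * eLpNorm w 1 volume := by
  rw [eLpNorm_one_eq_lintegral_enorm]
  refine (eLpNorm_integral_le_eLpNorm_lintegral _ p).trans
    ((eLpNorm_lintegral_smul_comp_sub_le (continuous_gradient_heatKernel t) hw.1 hp).trans ?_)
  gcongr
  exact eLpNorm_gradient_heatKernel_le ht hp

theorem eLpNorm_heatSource_le
    (hf : AEStronglyMeasurable (fun z : ℝ × EuclideanSpace ℝ (Fin N) => f z.1 z.2)
      ((volume.restrict (Ioo τ t)).prod volume)) {p : ℝ≥0∞} (hp : 1 ≤ p) {B : ℝ≥0∞}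
    (hB : ∀ s ∈ Ioo τ t, eLpNorm (f s) p volume ≤ B) :
    eLpNorm (heatSource τ t f) p volume ≤ B * ENNReal.ofReal (t - τ) := by
  rw [heatSource_eq_integral_smul, ← lintegral_Ioo_heatKernel (N := N) τ t]
  exact (eLpNorm_integral_le_eLpNorm_lintegral _ p).trans
    (eLpNorm_lintegral_smul_comp_sub_sub_le (K := fun s => heatKernel s)
      measurable_heatKernel_uncurry hf hp hB)

theorem eLpNorm_heatSourceGradient_le (hτt : τ ≤ t)
    (hf : AEStronglyMeasurable (fun z : ℝ × EuclideanSpace ℝ (Fin N) => f z.1 z.2)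
      ((volume.restrict (Ioo τ t)).prod volume)) {p : ℝ≥0∞} (hp : 1 ≤ p) {B : ℝ≥0∞}
    (hB : ∀ s ∈ Ioo τ t, eLpNorm (f s) p volume ≤ B) :
    eLpNorm (heatSourceGradient τ t f) p volume ≤
      B * ENNReal.ofReal (2 * (2 * 2 ^ ((N : ℝ) / 2)) * (t - τ) ^ (1 / 2 : ℝ)) :=
  (eLpNorm_integral_le_eLpNorm_lintegral _ p).trans
    ((eLpNorm_lintegral_smul_comp_sub_sub_le (K := fun s => gradient (heatKernel s))
      measurable_gradient_heatKernel_uncurry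
      hf hp hB).trans (by gcongr; exact lintegral_Ioo_gradient_heatKernel_le hτt))

theorem isWeakGradient_heatEvolution (ht : 0 < t) {w : EuclideanSpace ℝ (Fin N) → ℝ}
    (hw : Integrable w) : IsWeakGradient (heatEvolution t w) (heatEvolutionGradient t w) := by
  rw [heatEvolution_eq_integral_smul]
  have hk := aestronglyMeasurable_smul_comp_sub (continuous_heatKernel (N := N) t) hw.1
  have hd := aestronglyMeasurable_smul_comp_sub (continuous_gradient_heatKernel (N := N) t) hw.1
  refine IsWeakGradient.integral hk hd (fun K hK => ?_) (fun K hK => ?_)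
    (Eventually.of_forall fun y => isWeakGradient_heatKernel_sub t (w y) y)
  · refine setLIntegral_ne_top_of_eLpNorm_ne_top hk.enorm.lintegral_prod_right' le_rfl
      ((eLpNorm_lintegral_smul_comp_sub_le (continuous_heatKernel t) hw.1 le_rfl).trans_lt
        (ENNReal.mul_lt_top ?_ hw.2)).ne hK
    exact (eLpNorm_heatKernel_le ht le_rfl).trans_lt ENNReal.ofReal_lt_top
  · refine setLIntegral_ne_top_of_eLpNorm_ne_top hd.enorm.lintegral_prod_right' le_rfl
      ((eLpNorm_lintegral_smul_comp_sub_le (continuous_gradient_heatKernel t) hw.1 le_rfl).trans_lt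
        (ENNReal.mul_lt_top ?_ hw.2)).ne hK
    exact (eLpNorm_gradient_heatKernel_le ht le_rfl).trans_lt ENNReal.ofReal_lt_top

/-- The uniform L^p bound on f over (τ, t) compensates the singularity of ∇G at s = t: by Young the
absolute superpositions lie in L^p, hence are integrable on compact sets. -/
theorem isWeakGradient_heatSource (hτt : τ ≤ t)
    (hf : AEStronglyMeasurable (fun z : ℝ × EuclideanSpace ℝ (Fin N) => f z.1 z.2)
      ((volume.restrict (Ioo τ t)).prod volume)) {p : ℝ≥0∞} (hp : 1 ≤ p) {B : ℝ≥0∞}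
    (hBt : B ≠ ⊤) (hB : ∀ s ∈ Ioo τ t, eLpNorm (f s) p volume ≤ B) :
    IsWeakGradient (heatSource τ t f) (heatSourceGradient τ t f) := by
  rw [heatSource_eq_integral_smul]
  have hk := aestronglyMeasurable_smul_comp_sub_sub (K := fun s => heatKernel s)
    (measurable_heatKernel_uncurry (N := N)) hf
  have hd := aestronglyMeasurable_smul_comp_sub_sub (K := fun s => gradient (heatKernel s))
    (measurable_gradient_heatKernel_uncurry (N := N)) hf
  refine IsWeakGradient.integral hk hd (fun K hK => ?_) (fun K hK => ?_)
    (Eventually.of_forall fun z => isWeakGradient_heatKernel_sub (t - z.1) (f z.1 z.2) z.2)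
  · refine setLIntegral_ne_top_of_eLpNorm_ne_top hk.enorm.lintegral_prod_right' hp
      ((eLpNorm_lintegral_smul_comp_sub_sub_le (K := fun s => heatKernel s)
      measurable_heatKernel_uncurry hf hp
        hB).trans_lt (ENNReal.mul_lt_top hBt.lt_top ?_)).ne hK
    exact (lintegral_Ioo_heatKernel τ t).trans_lt ENNReal.ofReal_lt_top
  · refine setLIntegral_ne_top_of_eLpNorm_ne_top hd.enorm.lintegral_prod_right' hp
      ((eLpNorm_lintegral_smul_comp_sub_sub_le (K := fun s => gradient (heatKernel s))
      measurable_gradient_heatKernel_uncurry hf hp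
        hB).trans_lt (ENNReal.mul_lt_top hBt.lt_top ?_)).ne hK
    exact (lintegral_Ioo_gradient_heatKernel_le hτt).trans_lt ENNReal.ofReal_lt_top

end HeatGradient

/-! ### Restart at time t/2 and large-time rates -/

section LargeTime

variable {N : ℕ} {u₀ : EuclideanSpace ℝ (Fin N) → ℝ} {f u : ℝ → EuclideanSpace ℝ (Fin N) → ℝ}

theorem heatEvolution_sub_const_mul {t : ℝ} (ht : 0 < t)
    {v w : EuclideanSpace ℝ (Fin N) → ℝ} (hv : Integrable v) (hw : Integrable w) (c : ℝ)
    (x : EuclideanSpace ℝ (Fin N)) :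
    heatEvolution t (fun y => v y - c * w y) x = heatEvolution t v x - c * heatEvolution t w x := by
  have hi : ∀ g : EuclideanSpace ℝ (Fin N) → ℝ, Integrable g →
      Integrable fun y => heatKernel t (x - y) * g y := fun g hg =>
    hg.bdd_mul (c := (4 * Real.pi * t) ^ (-(N : ℝ) / 2))
      ((continuous_heatKernel t).comp (continuous_const.sub continuous_id)).aestronglyMeasurable
      (Eventually.of_forall fun y => by
        rw [Real.norm_of_nonneg (heatKernel_nonneg ht.le _)]
        exact heatKernel_le ht _)
  unfold heatEvolution
  simp_rw [mul_sub, mul_left_comm _ c]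
  rw [integral_sub (hi v hv) ((hi w hw).const_mul c), integral_const_mul]

/-- Decomposition of the deviation from the heat kernel, restarting the equation at time `t / 2`. -/
theorem IsHeatSolution.ae_eq_const_mul_heatKernel_add (hu : IsHeatSolution u₀ f u)
    (hu₀ : Integrable u₀ volume)
    (hf : Integrable (fun z : ℝ × EuclideanSpace ℝ (Fin N) => f z.1 z.2)
      ((volume.restrict (Ioi (0 : ℝ))).prod volume)) (I : ℝ) {t : ℝ} (ht : 0 < t) :
    u t =ᵐ[volume] fun x => I * heatKernel t x +
      (heatEvolution (t / 2) (fun y => u (t / 2) y - I * heatKernel (t / 2) y) x +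
        heatSource (t / 2) t f x) := by
  have ht2 : 0 < t / 2 := half_pos ht
  -- Writing I G(t) = G(t/2) * (I G(t/2)) absorbs the profile into the evolved datum.
  have h1 := heatKernel_add_ae_eq_heatEvolution (N := N) ht2 ht2
  rw [add_halves] at h1
  filter_upwards [hu.ae_eq_heatEvolution_add_heatSource hu₀ hf ht2.le (half_lt_self ht), h1]
    with x hx hx1
  rw [hx, heatEvolution_sub_const_mul ht2 (hu.integrable _ ht2.le) (integrable_heatKernel ht2),
    hx1, sub_half]
  ring

/-- A decay estimate of order `o(t^{-(1+a)})` is uniform on the intervals `(t/2, t)`. -/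
theorem eventually_forall_Ioo_half_le {b : ℝ → ℝ≥0∞} {a : ℝ} (ha : 0 ≤ a)
    (hb : Tendsto (fun t : ℝ => ENNReal.ofReal (t ^ (1 + a)) * b t) atTop (𝓝 0))
    {ε : ℝ≥0∞} (hε : 0 < ε) :
    ∀ᶠ t : ℝ in atTop, ∀ s ∈ Ioo (t / 2) t, b s ≤ ε * ENNReal.ofReal ((t / 2) ^ (-(1 + a))) := by
  obtain ⟨S, hS⟩ := eventually_atTop.1 (ENNReal.tendsto_nhds_zero.1 hb ε hε)
  filter_upwards [eventually_ge_atTop (2 * S), eventually_gt_atTop 0] with t htS ht s hs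
  have ht2 : 0 < t / 2 := half_pos ht
  have hs0 : 0 < s := ht2.trans hs.1
  have h1 := hS s (by linarith [hs.1])
  have h2 : ENNReal.ofReal (s ^ (-(1 + a))) * ENNReal.ofReal (s ^ (1 + a)) = 1 := by
    rw [← ENNReal.ofReal_mul (by positivity), ← Real.rpow_add hs0]
    simp
  calc b s = ENNReal.ofReal (s ^ (-(1 + a))) * (ENNReal.ofReal (s ^ (1 + a)) * b s) := by
        rw [← mul_assoc, h2, one_mul]
    _ ≤ ENNReal.ofReal ((t / 2) ^ (-(1 + a))) * ε := by
        gcongr ?_ * ?_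
        · exact ENNReal.ofReal_le_ofReal
            (Real.rpow_le_rpow_of_nonpos ht2 hs.1.le (by linarith))
    _ = _ := mul_comm _ _

/-- Common bookkeeping for the function (e = 0) and its gradient (e = 1/2). Since -(1+a) + (1-e) =
-(a+e), both terms have order t^{-(a+e)}, multiplied by W(t/2) → 0 and by the arbitrary ε. -/
theorem tendsto_ofReal_rpow_mul_zero {a e c : ℝ} {X W : ℝ → ℝ≥0∞}
    (hW : Tendsto W atTop (𝓝 0))
    (h : ∀ ε : ℝ≥0∞, 0 < ε → ∀ᶠ t : ℝ in atTop,
      X t ≤ ENNReal.ofReal (c * (t / 2) ^ (-(a + e))) * W (t / 2) +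
        ε * ENNReal.ofReal ((t / 2) ^ (-(1 + a))) * ENNReal.ofReal (c * (t / 2) ^ (1 - e))) :
    Tendsto (fun t : ℝ => ENNReal.ofReal (t ^ (a + e)) * X t) atTop (𝓝 0) := by
  rw [ENNReal.tendsto_nhds_zero]
  intro δ hδ
  -- D is the constant left after the powers of t/2 cancel. The choice ε = δ/(2D+1) makes the two
  -- contributions total at most δ, the +1 keeping the denominator nonzero.
  set D : ℝ≥0∞ := ENNReal.ofReal (c * 2 ^ (a + e)) with hD
  have hD1 : 2 * D + 1 ≠ ⊤ := by simp [hD, ENNReal.mul_eq_top]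
  have hD0 : 2 * D + 1 ≠ 0 := by simp
  have hε : 0 < δ / (2 * D + 1) := ENNReal.div_pos hδ.ne' hD1
  have hhalf : Tendsto (fun t : ℝ => t / 2) atTop atTop := tendsto_id.atTop_div_const two_pos
  filter_upwards [h _ hε, (hhalf.eventually (ENNReal.tendsto_nhds_zero.1 hW _ hε)),
    eventually_gt_atTop 0] with t h1 h2 ht
  have ht2 : 0 < t / 2 := half_pos ht
  have e0 : t ^ (a + e) = 2 ^ (a + e) * (t / 2) ^ (a + e) := by
    rw [← Real.mul_rpow two_pos.le ht2.le, mul_div_cancel₀ _ two_ne_zero]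
  have e1 : ENNReal.ofReal (t ^ (a + e)) * ENNReal.ofReal (c * (t / 2) ^ (-(a + e))) = D := by
    rw [← ENNReal.ofReal_mul (by positivity), hD, e0]
    congr 1
    have : (t / 2) ^ (a + e) * (t / 2) ^ (-(a + e)) = 1 := by
      rw [← Real.rpow_add ht2]; simp
    linear_combination (2 ^ (a + e) * c) * this
  have e2 : ENNReal.ofReal (t ^ (a + e)) * (ENNReal.ofReal ((t / 2) ^ (-(1 + a))) *
      ENNReal.ofReal (c * (t / 2) ^ (1 - e))) = D := by
    rw [← ENNReal.ofReal_mul (by positivity), ← ENNReal.ofReal_mul (by positivity), hD, e0]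
    congr 1
    have : (t / 2) ^ (a + e) * ((t / 2) ^ (-(1 + a)) * (t / 2) ^ (1 - e)) = 1 := by
      rw [← Real.rpow_add ht2, ← Real.rpow_add ht2]; ring_nf; simp
    linear_combination (2 ^ (a + e) * c) * this
  set η := δ / (2 * D + 1) with hη
  calc ENNReal.ofReal (t ^ (a + e)) * X t
      ≤ ENNReal.ofReal (t ^ (a + e)) * (ENNReal.ofReal (c * (t / 2) ^ (-(a + e))) * η +
        η * ENNReal.ofReal ((t / 2) ^ (-(1 + a))) * ENNReal.ofReal (c * (t / 2) ^ (1 - e))) := by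
        refine mul_le_mul_right (h1.trans ?_) _
        gcongr
    _ = D * η + η * D := by
        rw [mul_add, ← mul_assoc, e1, mul_assoc η, mul_left_comm _ η, e2]
    _ ≤ η * (2 * D + 1) := by
        rw [mul_add, mul_comm D, ← mul_add, ← two_mul]
        exact le_self_add
    _ ≤ δ := (ENNReal.div_mul_cancel hD0 hD1).le

end LargeTime

/-! ### The main theorem -/

theorem mainTheorem10 (N : ℕ) (hN : 1 ≤ N)
    (u₀ : EuclideanSpace ℝ (Fin N) → ℝ) (hu₀ : Integrable u₀ volume)
    (f : ℝ → EuclideanSpace ℝ (Fin N) → ℝ)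
    (hf : Integrable (fun z : ℝ × EuclideanSpace ℝ (Fin N) => f z.1 z.2)
      ((volume.restrict (Ioi (0 : ℝ))).prod volume))
    (u : ℝ → EuclideanSpace ℝ (Fin N) → ℝ) (hu : IsHeatSolution u₀ f u) :
    ∃ I : ℝ,
      Tendsto (fun t : ℝ => ∫ x, u t x) atTop (𝓝 I) ∧
      I = (∫ x, u₀ x) + ∫ t in Ioi (0 : ℝ), ∫ x, f t x ∧
      Tendsto (fun t : ℝ => eLpNorm (fun x => u t x - I * heatKernel t x) 1 volume)
        atTop (𝓝 0) ∧
      ∀ p : ℝ≥0∞, 1 ≤ p → (∀ t : ℝ, 0 < t → MemLp (f t) p volume) →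
        Tendsto (fun t : ℝ => ENNReal.ofReal (t ^ (1 + (N : ℝ) / 2 * (1 - (p⁻¹).toReal))) *
          eLpNorm (f t) p volume) atTop (𝓝 0) →
        Tendsto (fun t : ℝ => ENNReal.ofReal (t ^ ((N : ℝ) / 2 * (1 - (p⁻¹).toReal))) *
          eLpNorm (fun x => u t x - I * heatKernel t x) p volume) atTop (𝓝 0) ∧
        ∃ Du : ℝ → EuclideanSpace ℝ (Fin N) → EuclideanSpace ℝ (Fin N),
          (∀ᶠ t in atTop, IsWeakGradient (u t) (Du t)) ∧
          Tendsto (fun t : ℝ =>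
            ENNReal.ofReal (t ^ ((N : ℝ) / 2 * (1 - (p⁻¹).toReal) + 1 / 2)) *
            eLpNorm (fun x => Du t x - I • gradient (heatKernel t) x) p volume)
            atTop (𝓝 0) := by
  have hL1 := hu.tendsto_eLpNorm_one hu₀ hf
  refine ⟨(∫ x, u₀ x) + ∫ t in Ioi (0 : ℝ), ∫ x, f t x, hu.tendsto_integral hu₀ hf, rfl, hL1,
    fun p hp _ hfp => ?_⟩
  set I := (∫ x, u₀ x) + ∫ t in Ioi (0 : ℝ), ∫ x, f t x
  have hα0 : 0 ≤ (N : ℝ) / 2 * (1 - (p⁻¹).toReal) := by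
    have : (p⁻¹).toReal ≤ 1 := by
      rw [← ENNReal.toReal_one]
      exact ENNReal.toReal_mono ENNReal.one_ne_top (ENNReal.inv_le_one.2 hp)
    exact mul_nonneg (by positivity) (by linarith)
  set α := (N : ℝ) / 2 * (1 - (p⁻¹).toReal) with hα
  let w : ℝ → EuclideanSpace ℝ (Fin N) → ℝ := fun t y => u t y - I * heatKernel t y
  have hw : ∀ t, 0 < t → Integrable (w t) := fun t ht =>
    (hu.integrable t ht.le).sub ((integrable_heatKernel ht).const_mul I)
  have hfm : ∀ t : ℝ, 0 < t → AEStronglyMeasurable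
      (fun z : ℝ × EuclideanSpace ℝ (Fin N) => f z.1 z.2)
      ((volume.restrict (Ioo (t / 2) t)).prod volume) := fun t ht =>
    (integrable_prod_Ioo hf (half_pos ht).le t).1
  have hdec : ∀ t, 0 < t → u t =ᵐ[volume] fun x => I * heatKernel t x +
      (heatEvolution (t / 2) (w (t / 2)) x + heatSource (t / 2) t f x) := fun t ht =>
    hu.ae_eq_const_mul_heatKernel_add hu₀ hf I ht
  -- The gradient candidate differentiates the kernels in the decomposition at t/2. It is shown to
  -- be the weak gradient once t is so large that f is bounded in L^p on (t/2, t).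
  refine ⟨?_, fun t x => I • gradient (heatKernel t) x +
    (heatEvolutionGradient (t / 2) (w (t / 2)) x + heatSourceGradient (t / 2) t f x), ?_, ?_⟩
  · rw [← add_zero α]
    refine tendsto_ofReal_rpow_mul_zero (c := 1) hL1 fun ε hε => ?_
    filter_upwards [eventually_forall_Ioo_half_le hα0 hfp hε, eventually_gt_atTop 0] with t hB ht
    have ht2 := half_pos ht
    have e : (fun x => u t x - I * heatKernel t x) =ᵐ[volume]
        heatEvolution (t / 2) (w (t / 2)) + heatSource (t / 2) t f := by
      filter_upwards [hdec t ht] with x hx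
      rw [hx, add_sub_cancel_left, Pi.add_apply]
    rw [eLpNorm_congr_ae e]
    refine (eLpNorm_add_le (integrable_heatEvolution ht2 (hw _ ht2)).1
      (integrable_heatSource (integrable_prod_Ioo hf ht2.le t)).1 hp).trans (add_le_add ?_ ?_)
    · rw [add_zero, one_mul]
      exact eLpNorm_heatEvolution_le ht2 (hw _ ht2) hp
    · have := eLpNorm_heatSource_le (hfm t ht) hp hB
      simpa [sub_half] using this
  -- Only finiteness of the bound on f matters here, so ε = 1 suffices.
  · filter_upwards [eventually_forall_Ioo_half_le hα0 hfp one_pos, eventually_gt_atTop 0]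
      with t hB ht
    have h0 : IsWeakGradient (fun x : EuclideanSpace ℝ (Fin N) => I * heatKernel t x)
        (fun x => I • gradient (heatKernel t) x) :=
      (isWeakGradient_gradient (contDiff_heatKernel t)).const_mul I
    exact (h0.add ((isWeakGradient_heatEvolution (half_pos ht) (hw _ (half_pos ht))).add
      (isWeakGradient_heatSource (half_le_self ht.le) (hfm t ht) hp
        (ENNReal.mul_ne_top ENNReal.one_ne_top ENNReal.ofReal_ne_top) hB))).congr_ae
      (hdec t ht).symm
  · simp_rw [add_sub_cancel_left]
    -- The constant comes from the source term, where integrating (t-s)^{-1/2} doubles 2 · 2^{N/2};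
    -- it also majorizes the constant of the evolution term.
    refine tendsto_ofReal_rpow_mul_zero (c := 2 * (2 * 2 ^ ((N : ℝ) / 2))) hL1
      fun ε hε => ?_
    filter_upwards [eventually_forall_Ioo_half_le hα0 hfp hε, eventually_gt_atTop 0] with t hB ht
    have ht2 := half_pos ht
    have hw2 := hw _ ht2
    refine (eLpNorm_add_le
      (isWeakGradient_heatEvolution ht2 hw2).locallyIntegrable_gradient.aestronglyMeasurable
      (aestronglyMeasurable_smul_comp_sub_sub (K := fun s => gradient (heatKernel s))
        measurable_gradient_heatKernel_uncurry (hfm t ht)).integral_prod_right' hp).trans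
      (add_le_add ?_ ?_)
    · refine (eLpNorm_heatEvolutionGradient_le ht2 hw2 hp).trans ?_
      gcongr
      nlinarith [Real.rpow_pos_of_pos two_pos ((N : ℝ) / 2)]
    · have := eLpNorm_heatSourceGradient_le (half_le_self ht.le) (hfm t ht) hp hB
      rw [sub_half] at this
      convert! this using 5
      norm_num
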